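/- Let $(M,g)$ be a connected smooth pseudo-Riemannian manifold of dimension $n$, let $\eta$ be a constant non-degenerate symmetric form with the signature of $g$, and let $R^i=\nabla^iR$ denote the $i$-th covariant derivative of the Riemann curvature tensor. All frames are smooth local $\eta$-orthogonal frames. Assume that the curvature tensor and its covariant derivatives are of constant algebraic type, so that the Karlhede algorithm can be carried out: starting with $G_{-1}=O(\eta)$ and with all frames permitted, for $q=0,1,2,\dots$ one fixes a set of standard forms for the components of $R^q$ that contains at most one element of each $G_{q-1}$-orbit, and from then on permits only the frames, among those permitted so far, in which $R^q$ is in standard form. It is assumed that for every $q$ such frames exist around every point, and that the subgroup $G_q\subset O(\eta)$ that leaves $R^{(q)}=\{R^0,\dots,R^q\}$ invariant relative to these frames is the same at all points. Put $N_q=\dim G_q$, let $t_{-1}=0$, and let $t_q$ be the number of functionally independent functions among the components of $R^{(q)}$ relative to the permitted frames (the maximal number of components whose differentials are linearly independent at some point). Let $q_M$ be the smallest $q\ge 0$ for which neither $N_q<N_{q-1}$ nor $t_q>t_{q-1}$. The groups $G_q$ are said to pseudo-stabilize if $N_i=N_{i+1}>N_{i+2}$ for some $i\ge 0$. The manifold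 is called $\mathrm{CH}_k$ if there are constant arrays which, near every point, are the components of $R^0,\dots,R^k$ relative to some $\eta$-orthogonal frame field, and properly $\mathrm{CH}_k$ if it is $\mathrm{CH}_k$ but not $\mathrm{CH}_{k+1}$. **Proposition.** Suppose that $q_M=N_0+n+1$, i.e. that the Karlhede bound is attained, and that the groups $G_q$ do not pseudo-stabilize. Then $M$ is properly $\mathrm{CH}_k$ with $k=N_0$. -/

import Mathlib

open Bundle Topology
open scoped Manifold ContDiff Matrix

noncomputable section

section Geometry

variable {n : ℕ} {M : Type*} [TopologicalSpace M]
  [ChartedSpace (EuclideanSpace ℝ (Fin n)) M]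

/-- Vector fields on an `n`-dimensional manifold (arbitrary sections of the tangent bundle;
only their restrictions to open sets where they are smooth are ever relevant). -/
abbrev VField (n : ℕ) (M : Type*) [TopologicalSpace M]
    [ChartedSpace (EuclideanSpace ℝ (Fin n)) M] : Type _ :=
  (x : M) → TangentSpace (𝓡 n) x

/-- A smooth pseudo-Riemannian metric: a smooth field of symmetric non-degenerate bilinear forms
on the tangent spaces. -/
structure PseudoRiemannianMetric (n : ℕ) (M : Type*) [TopologicalSpace M]
    [ChartedSpace (EuclideanSpace ℝ (Fin n)) M] [IsManifold (𝓡 n) ∞ M] where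
  form (x : M) : TangentSpace (𝓡 n) x →L[ℝ] TangentSpace (𝓡 n) x →L[ℝ] ℝ
  symm (x : M) (v w : TangentSpace (𝓡 n) x) : form x v w = form x w v
  nondegenerate (x : M) (v : TangentSpace (𝓡 n) x) (hv : ∀ w, form x v w = 0) : v = 0
  contMDiff : ContMDiff (𝓡 n)
    ((𝓡 n).prod 𝓘(ℝ, EuclideanSpace ℝ (Fin n) →L[ℝ] EuclideanSpace ℝ (Fin n) →L[ℝ] ℝ)) ∞
    (fun x ↦ TotalSpace.mk' (EuclideanSpace ℝ (Fin n) →L[ℝ] EuclideanSpace ℝ (Fin n) →L[ℝ] ℝ)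
      (E := fun x ↦ TangentSpace (𝓡 n) x →L[ℝ] TangentSpace (𝓡 n) x →L[ℝ] ℝ) x (form x))

/-- The derivative `X f` of a function along a vector field. -/
def dirDeriv (X : VField n M) (f : M → ℝ) (x : M) : ℝ :=
  mvfderiv (𝓡 n) f x (X x)

namespace PseudoRiemannianMetric

variable [IsManifold (𝓡 n) ∞ M] (g : PseudoRiemannianMetric n M)

/-- The function `g(X, Y)`. -/
def pairing (X Y : VField n M) (x : M) : ℝ := g.form x (X x) (Y x)

/-- The right-hand side of the Koszul formula for `2 g(∇_X Y, Z)`. -/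
def koszul (X Y Z : VField n M) (x : M) : ℝ :=
  dirDeriv X (g.pairing Y Z) x + dirDeriv Y (g.pairing Z X) x - dirDeriv Z (g.pairing X Y) x
    + g.pairing (VectorField.mlieBracket (𝓡 n) X Y) Z x
    - g.pairing (VectorField.mlieBracket (𝓡 n) X Z) Y x
    - g.pairing (VectorField.mlieBracket (𝓡 n) Y Z) X x

/-- `v` is the value at `x` of the Levi-Civita derivative `∇_X Y`, according to Koszul's formula. -/
def IsLeviCivitaValue (X Y : VField n M) (x : M) (v : TangentSpace (𝓡 n) x) : Prop :=
  ∀ Z : VField n M,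
    MDifferentiableAt (𝓡 n) (𝓡 n).tangent (fun y ↦ (⟨y, Z y⟩ : TangentBundle (𝓡 n) M)) x →
      2 * g.form x v (Z x) = g.koszul X Y Z x

open Classical in
/-- The Levi-Civita connection `∇_X Y`. At points where `X` and `Y` are differentiable, the vector
characterized by Koszul's formula exists and is unique. -/
def leviCivita (X Y : VField n M) : VField n M := fun x ↦
  if h : ∃ v, g.IsLeviCivitaValue X Y x v then h.choose else 0

/-- The Riemann curvature tensor `g(∇_X ∇_Y Z - ∇_Y ∇_X Z - ∇_[X,Y] Z, W)`. -/
def riemann (X Y Z W : VField n M) (x : M) : ℝ :=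
  g.form x (g.leviCivita X (g.leviCivita Y Z) x - g.leviCivita Y (g.leviCivita X Z) x
    - g.leviCivita (VectorField.mlieBracket (𝓡 n) X Y) Z x) (W x)

/-- The covariant derivative of a covariant `m`-tensor field `T`, viewed as a function of vector
fields; the differentiating field is the last argument. -/
def covDeriv {m : ℕ} (T : (Fin m → VField n M) → M → ℝ) (X : Fin (m + 1) → VField n M) (x : M) :
    ℝ :=
  dirDeriv (X (Fin.last m)) (T (Fin.init X)) x
    - ∑ j : Fin m, T (Function.update (Fin.init X) j
        (g.leviCivita (X (Fin.last m)) (Fin.init X j))) x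

/-- The `i`-th covariant derivative `∇^i R` of the curvature tensor, a covariant tensor field of
rank `4 + i`. -/
def curvatureDeriv : (i : ℕ) → (Fin (4 + i) → VField n M) → M → ℝ
  | 0 => fun X ↦ g.riemann (X 0) (X 1) (X 2) (X 3)
  | i + 1 => g.covDeriv (curvatureDeriv i)

/-- The components at `x` of `R^i = ∇^i R` relative to a frame field `e`. -/
def components (e : Fin n → VField n M) (i : ℕ) (x : M) : (Fin (4 + i) → Fin n) → ℝ :=
  fun a ↦ g.curvatureDeriv i (fun j ↦ e (a j)) x

/-- `e` is a smooth `η`-orthogonal frame field on the open set `U`. -/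
structure IsOrthogonalFrameOn (η : Matrix (Fin n) (Fin n) ℝ) (e : Fin n → VField n M)
    (U : Set M) : Prop where
  isOpen : IsOpen U
  isLocalFrame : IsLocalFrameOn (𝓡 n) (EuclideanSpace ℝ (Fin n)) ∞ e U
  orthogonal : ∀ x ∈ U, ∀ a b, g.form x (e a x) (e b x) = η a b

/-- Curvature homogeneity of order `k` (the class `CH_k`): there are constant arrays
`R̃^0, …, R̃^k` that, near every point, are the components of `R, ∇R, …, ∇^k R` relative to some
`η`-orthogonal frame field. -/
def IsCurvatureHomogeneous (η : Matrix (Fin n) (Fin n) ℝ) (k : ℕ) : Prop :=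
  ∃ C : (i : ℕ) → (Fin (4 + i) → Fin n) → ℝ,
    ∀ x : M, ∃ (U : Set M) (e : Fin n → VField n M), x ∈ U ∧ g.IsOrthogonalFrameOn η e U ∧
      ∀ i ≤ k, ∀ y ∈ U, g.components e i y = C i

/-- Proper curvature homogeneity: `CH_k` but not `CH_{k+1}`. -/
def IsProperlyCurvatureHomogeneous (η : Matrix (Fin n) (Fin n) ℝ) (k : ℕ) : Prop :=
  g.IsCurvatureHomogeneous η k ∧ ¬ g.IsCurvatureHomogeneous η (k + 1)

end PseudoRiemannianMetric

end Geometry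

section Algebra

variable {n : ℕ}

/-- The components of a covariant `m`-tensor relative to the frame `e'_a = ∑_b X_{ba} e_b`, given
its components `T` relative to the frame `e`. -/
def frameChange {m : ℕ} (X : Matrix (Fin n) (Fin n) ℝ) (T : (Fin m → Fin n) → ℝ) :
    (Fin m → Fin n) → ℝ :=
  fun a ↦ ∑ b : Fin m → Fin n, (∏ j, X (b j) (a j)) * T b

theorem frameChange_one {m : ℕ} (T : (Fin m → Fin n) → ℝ) : frameChange 1 T = T := by
  funext a
  unfold frameChange
  rw [Finset.sum_eq_single a]
  · simp
  · intro b _ hb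
    obtain ⟨j, hj⟩ := Function.ne_iff.mp hb
    rw [Finset.prod_eq_zero (Finset.mem_univ j) (by simp [hj]), zero_mul]
  · simp

theorem frameChange_mul {m : ℕ} (X Y : Matrix (Fin n) (Fin n) ℝ) (T : (Fin m → Fin n) → ℝ) :
    frameChange (X * Y) T = frameChange Y (frameChange X T) := by
  funext a
  simp only [frameChange, Matrix.mul_apply, Finset.prod_univ_sum, Fintype.piFinset_univ,
    Finset.prod_mul_distrib, Finset.sum_mul, Finset.mul_sum]
  rw [Finset.sum_comm]
  refine Finset.sum_congr rfl fun c _ ↦ Finset.sum_congr rfl fun b _ ↦ ?_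
  ring

/-- The group `O(η)` of `η`-orthogonal transformations. -/
def orthogonalGroupOf (η : Matrix (Fin n) (Fin n) ℝ) : Subgroup (GL (Fin n) ℝ) where
  carrier := {X | (X : Matrix (Fin n) (Fin n) ℝ)ᵀ * η * (X : Matrix (Fin n) (Fin n) ℝ) = η}
  one_mem' := by simp
  mul_mem' {X Y} hX hY := by
    simp only [Set.mem_ofPred_eq, Units.val_mul, Matrix.transpose_mul] at *
    calc _ = (Y : Matrix (Fin n) (Fin n) ℝ)ᵀ *
          ((X : Matrix (Fin n) (Fin n) ℝ)ᵀ * η * (X : Matrix (Fin n) (Fin n) ℝ)) *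
          (Y : Matrix (Fin n) (Fin n) ℝ) := by simp only [Matrix.mul_assoc]
      _ = η := by rw [hX, hY]
  inv_mem' {X} hX := by
    simp only [Set.mem_ofPred_eq] at *
    have h1 : (X : Matrix (Fin n) (Fin n) ℝ) * ((X⁻¹ : GL (Fin n) ℝ) : Matrix _ _ ℝ) = 1 := by
      rw [← Units.val_mul, mul_inv_cancel, Units.val_one]
    have h2 : ((X⁻¹ : GL (Fin n) ℝ) : Matrix (Fin n) (Fin n) ℝ)ᵀ *
        (X : Matrix (Fin n) (Fin n) ℝ)ᵀ = 1 := by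
      rw [← Matrix.transpose_mul, h1, Matrix.transpose_one]
    calc _ = ((X⁻¹ : GL (Fin n) ℝ) : Matrix (Fin n) (Fin n) ℝ)ᵀ *
          ((X : Matrix (Fin n) (Fin n) ℝ)ᵀ * η * (X : Matrix (Fin n) (Fin n) ℝ)) *
          ((X⁻¹ : GL (Fin n) ℝ) : Matrix (Fin n) (Fin n) ℝ) := by rw [hX]
      _ = (((X⁻¹ : GL (Fin n) ℝ) : Matrix (Fin n) (Fin n) ℝ)ᵀ *
          (X : Matrix (Fin n) (Fin n) ℝ)ᵀ) * η * ((X : Matrix (Fin n) (Fin n) ℝ) *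
          ((X⁻¹ : GL (Fin n) ℝ) : Matrix (Fin n) (Fin n) ℝ)) := by
        simp only [Matrix.mul_assoc]
      _ = η := by rw [h1, h2, Matrix.one_mul, Matrix.mul_one]

/-- The group of linear transformations that leave a covariant tensor invariant. -/
def tensorStabilizer {m : ℕ} (T : (Fin m → Fin n) → ℝ) : Subgroup (GL (Fin n) ℝ) where
  carrier := {X | frameChange (X : Matrix (Fin n) (Fin n) ℝ) T = T}
  one_mem' := by simp [frameChange_one]
  mul_mem' {X Y} hX hY := by
    simp only [Set.mem_ofPred_eq, Units.val_mul] at *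
    rw [frameChange_mul, hX, hY]
  inv_mem' {X} hX := by
    simp only [Set.mem_ofPred_eq] at *
    have h : (X : Matrix (Fin n) (Fin n) ℝ) * ((X⁻¹ : GL (Fin n) ℝ) : Matrix _ _ ℝ) = 1 := by
      rw [← Units.val_mul, mul_inv_cancel, Units.val_one]
    conv_lhs => rw [← hX]
    rw [← frameChange_mul, h, frameChange_one]

/-- The Lie algebra of a closed matrix group `G`: all `A` with `exp (tA) ∈ G` for all real `t`.
(For closed `G` these `A` form a linear subspace, so that taking the span changes nothing.) -/
def matrixLieAlgebra (G : Subgroup (GL (Fin n) ℝ)) : Submodule ℝ (Matrix (Fin n) (Fin n) ℝ) :=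
  Submodule.span ℝ {A | ∀ t : ℝ, ∃ X ∈ G, (X : Matrix (Fin n) (Fin n) ℝ) = NormedSpace.exp (t • A)}

/-- The dimension of a closed matrix group. -/
def groupDim (G : Subgroup (GL (Fin n) ℝ)) : ℕ := Module.finrank ℝ (matrixLieAlgebra G)

end Algebra

section Karlhede

variable {n : ℕ} {M : Type*} [TopologicalSpace M]
  [ChartedSpace (EuclideanSpace ℝ (Fin n)) M] [IsManifold (𝓡 n) ∞ M]

namespace PseudoRiemannianMetric

/-- The automorphism group of `R^(q) = {R^0, …, R^q}` at `x`, relative to the frame `e`. -/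
def automorphismGroup (g : PseudoRiemannianMetric n M) (η : Matrix (Fin n) (Fin n) ℝ)
    (e : Fin n → VField n M) (q : ℕ) (x : M) : Subgroup (GL (Fin n) ℝ) :=
  orthogonalGroupOf η ⊓ ⨅ i ∈ Set.Iic q, tensorStabilizer (g.components e i x)

/-- Given sets `S i` of standard forms for the curvature arrays `R^i`, the frame fields that are
permitted on `U` once `R^i` has been put into standard form for all `i < s`.  For `s = 0` these are
all `η`-orthogonal frames. -/
def IsPermittedFrameOn (g : PseudoRiemannianMetric n M) (η : Matrix (Fin n) (Fin n) ℝ)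
    (S : (i : ℕ) → Set ((Fin (4 + i) → Fin n) → ℝ)) (s : ℕ) (e : Fin n → VField n M)
    (U : Set M) : Prop :=
  g.IsOrthogonalFrameOn η e U ∧ ∀ i < s, ∀ x ∈ U, g.components e i x ∈ S i

/-- The number of linearly independent differentials at `x` among the component functions of
`R^0, …, R^q` relative to the frame field `e`. -/
def componentRank (g : PseudoRiemannianMetric n M) (e : Fin n → VField n M) (q : ℕ) (x : M) : ℕ :=
  Module.finrank ℝ (Submodule.span ℝ
    {L : TangentSpace (𝓡 n) x →L[ℝ] ℝ | ∃ i ≤ q, ∃ a : Fin (4 + i) → Fin n,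
      L = mvfderiv (𝓡 n) (fun y ↦ g.components e i y a) x})

end PseudoRiemannianMetric

/-- The groups `G_{-1} = O(η), G_0, G_1, …`, with the index shifted by one. -/
def groupBefore (η : Matrix (Fin n) (Fin n) ℝ) (G : ℕ → Subgroup (GL (Fin n) ℝ)) :
    ℕ → Subgroup (GL (Fin n) ℝ)
  | 0 => orthogonalGroupOf η
  | q + 1 => G q

/-- The choices made in a run of the Karlhede algorithm on a metric whose curvature tensor and
covariant derivatives thereof have constant algebraic type: at each order `q`, a set of standard
forms for `R^q`, containing at most one element of each orbit of `G_{q-1}`, such that `R^0, …, R^q`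
can be put into standard form by smooth frames around every point, and such that their automorphism
group `G_q` relative to the resulting permitted frames does not depend on the point. -/
structure KarlhedeNormalization (g : PseudoRiemannianMetric n M)
    (η : Matrix (Fin n) (Fin n) ℝ) where
  standardForm : (i : ℕ) → Set ((Fin (4 + i) → Fin n) → ℝ)
  G : ℕ → Subgroup (GL (Fin n) ℝ)
  standardForm_unique : ∀ q, ∀ T ∈ standardForm q, ∀ X ∈ groupBefore η G q,
    frameChange (X : Matrix (Fin n) (Fin n) ℝ) T ∈ standardForm q →
      frameChange (X : Matrix (Fin n) (Fin n) ℝ) T = T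
  exists_permitted : ∀ (q : ℕ) (x : M), ∃ (U : Set M) (e : Fin n → VField n M),
    x ∈ U ∧ g.IsPermittedFrameOn η standardForm (q + 1) e U
  automorphismGroup_eq : ∀ (q : ℕ) (U : Set M) (e : Fin n → VField n M),
    g.IsPermittedFrameOn η standardForm (q + 1) e U →
      ∀ x ∈ U, g.automorphismGroup η e q x = G q

namespace KarlhedeNormalization

variable {g : PseudoRiemannianMetric n M} {η : Matrix (Fin n) (Fin n) ℝ}
  (K : KarlhedeNormalization g η)

/-- `N_q = dim G_q`. -/
def N (q : ℕ) : ℕ := groupDim (K.G q)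

/-- `N_{q-1}`, where `G_{-1} = O(η)`. -/
def Nprev (q : ℕ) : ℕ := groupDim (groupBefore η K.G q)

/-- `t_q`, the number of functionally independent functions in `R^(q)` relative to the permitted
frames: the maximal number of components with linearly independent differentials at a point. -/
def t (q : ℕ) : ℕ :=
  sSup {r | ∃ (U : Set M) (e : Fin n → VField n M) (x : M), x ∈ U ∧
    g.IsPermittedFrameOn η K.standardForm (q + 1) e U ∧ r = g.componentRank e q x}

/-- `t_{q-1}`, where `t_{-1} = 0`. -/
def tprev : ℕ → ℕ
  | 0 => 0
  | q + 1 => K.t q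

/-- `q` is the order `q_M` at which the algorithm terminates: the first order at which neither
`N_q < N_{q-1}` nor `t_q > t_{q-1}`. -/
def IsICOrder (q : ℕ) : Prop :=
  IsLeast {q : ℕ | ¬ (K.N q < K.Nprev q ∨ K.tprev q < K.t q)} q

/-- Pseudo-stabilization of the curvature automorphism groups. -/
def PseudoStabilizes : Prop := ∃ i : ℕ, K.N i = K.N (i + 1) ∧ K.N (i + 2) < K.N (i + 1)

end KarlhedeNormalization

end Karlhede

end

/-! The statement splits into a combinatorial half and a geometric half, joined by the equivalence:
`M` is CH_k if and only if t_k = 0.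

Counting (`eq_zero_and_pos_of_steps`). Before order q_M = N_0 + n + 1, each of the N_0 + n steps
from order q to q + 1 lowers N or raises t. In total N can lose at most N_0 and t can gain at most
n, so nothing is wasted: t_0 = 0, and every step changes exactly one of the two, by one. Without
pseudo-stabilization, N never moves again once it has paused. Since it must reach 0, its N_0 drops
come first. Hence t_{N_0} = 0 and t_{N_0+1} > 0.

Equivalence. If t_k = 0, the components of R^0, …, R^k in permitted frames have vanishing
differentials, so they are locally constant. They do not depend on the permitted frame
(`components_eq`), so connectedness makes them globally constant
(`isCurvatureHomogeneous_of_t_eq_zero`). Conversely, near a point where some orthogonal frame has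
constant components, the components in a permitted frame at two points differ by an element of O(η).
As a set of standard forms meets each orbit at most once, they coincide, and all differentials
vanish (`t_eq_zero_of_isCurvatureHomogeneous`). Both directions rest on
`components_eq_of_frameChange`.

To compare frames at all, ∇^i R must be a tensor. The Levi-Civita derivative is defined by choice on
arbitrary sections, so tensoriality is proved for fields smooth on an open set carrying an
orthogonal frame (`isTensorOn_curvatureDeriv`); it yields `exists_components_eq_frameChange`. -/

section VectorFieldCalculus

/-! ### Calculus of smooth vector fields: directional derivatives and Lie brackets. -/

variable {n : ℕ} {M : Type*} [TopologicalSpace M]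
  [ChartedSpace (EuclideanSpace ℝ (Fin n)) M]

/-- The function `f` is smooth on `U`. -/
abbrev SmoothFunOn (f : M → ℝ) (U : Set M) : Prop := ContMDiffOn (𝓡 n) 𝓘(ℝ, ℝ) ∞ f U

/-- The function `f` is differentiable at `x`. -/
abbrev DiffFunAt (f : M → ℝ) (x : M) : Prop := MDifferentiableAt (𝓡 n) 𝓘(ℝ, ℝ) f x

variable {X Y Z X' Y' Z' : VField n M} {f h : M → ℝ} {x : M} {U V : Set M}

theorem SmoothFunOn.diffFunAt (hf : SmoothFunOn (n := n) f U) (hU : IsOpen U) (hx : x ∈ U) :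
    DiffFunAt (n := n) f x :=
  ((hf x hx).contMDiffAt (hU.mem_nhds hx)).mdifferentiableAt (by simp)

theorem dirDeriv_add_left : dirDeriv (X + Y) f x = dirDeriv X f x + dirDeriv Y f x := by
  simp [dirDeriv]

theorem dirDeriv_smul_left : dirDeriv (f • X) h x = f x * dirDeriv X h x := by
  simp [dirDeriv]

theorem dirDeriv_add (hf : DiffFunAt (n := n) f x) (hh : DiffFunAt (n := n) h x) :
    dirDeriv X (f + h) x = dirDeriv X f x + dirDeriv X h x := by
  rw [dirDeriv, mvfderiv_add hf hh]; rfl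

theorem dirDeriv_mul (hf : DiffFunAt (n := n) f x) (hh : DiffFunAt (n := n) h x) :
    dirDeriv X (f * h) x = f x * dirDeriv X h x + h x * dirDeriv X f x := by
  rw [dirDeriv, mvfderiv_mul hf hh]; rfl

theorem dirDeriv_congr (hX : X x = Y x) (hf : f =ᶠ[𝓝 x] h) : dirDeriv X f x = dirDeriv Y h x := by
  rw [dirDeriv, dirDeriv, hX, mvfderiv, mvfderiv, hf.mfderiv_eq]
  simp only [ContinuousLinearMap.comp_apply]
  rfl

variable [IsManifold (𝓡 n) ∞ M]

/-- The vector field `X` is smooth on `U`. -/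
def VField.SmoothOn (X : VField n M) (U : Set M) : Prop :=
  ContMDiffOn (𝓡 n) (𝓡 n).tangent ∞ (fun y ↦ (⟨y, X y⟩ : TangentBundle (𝓡 n) M)) U

/-- The vector field `X` is differentiable at `x`. -/
def VField.DiffAt (X : VField n M) (x : M) : Prop :=
  MDifferentiableAt (𝓡 n) (𝓡 n).tangent (fun y ↦ (⟨y, X y⟩ : TangentBundle (𝓡 n) M)) x

theorem VField.SmoothOn.diffAt (hX : X.SmoothOn U) (hU : IsOpen U) (hx : x ∈ U) : X.DiffAt x :=
  ((hX x hx).contMDiffAt (hU.mem_nhds hx)).mdifferentiableAt (by simp)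

theorem VField.SmoothOn.dirDeriv (hX : X.SmoothOn U) (hf : SmoothFunOn (n := n) f U)
    (hU : IsOpen U) : SmoothFunOn (n := n) (dirDeriv X f) U := by
  have : IsManifold (𝓡 n) 1 M := IsManifold.of_le (n := ∞) (by simp)
  have h1 := hf.contMDiffOn_tangentMapWithin (m := ∞) (by simp) hU.uniqueMDiffOn
  have h2 := (contMDiff_snd_tangentBundle_modelSpace (n := ∞) ℝ 𝓘(ℝ, ℝ)).comp_contMDiffOn
    (h1.comp hX (fun y hy ↦ hy))
  refine h2.congr fun y hy ↦ ?_
  change mfderiv (𝓡 n) 𝓘(ℝ, ℝ) f y (X y) = mfderivWithin (𝓡 n) 𝓘(ℝ, ℝ) f U y (X y)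
  rw [mfderivWithin_of_isOpen hU hy]

theorem VField.SmoothOn.mlieBracket (hX : X.SmoothOn U) (hY : Y.SmoothOn U) (hU : IsOpen U) :
    VField.SmoothOn (VectorField.mlieBracket (𝓡 n) X Y) U := by
  intro y hy
  have : IsManifold (𝓡 n) (((⊤ : ℕ∞) : ℕ∞ω) + 1) M := by simpa
  have : IsManifold (𝓡 n) (minSmoothness ℝ 2) M := by simp; infer_instance
  exact (ContMDiffAt.mlieBracket_vectorField (m := ⊤) (n := ⊤)
    ((hX y hy).contMDiffAt (hU.mem_nhds hy)) ((hY y hy).contMDiffAt (hU.mem_nhds hy))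
    (by simp)).contMDiffWithinAt

theorem VField.SmoothOn.add (hX : X.SmoothOn U) (hY : Y.SmoothOn U) : (X + Y).SmoothOn U :=
  ContMDiffOn.add_section hX hY

theorem VField.SmoothOn.smul (hX : X.SmoothOn U) (hf : SmoothFunOn (n := n) f U) :
    VField.SmoothOn (f • X) U :=
  ContMDiffOn.smul_section hf hX

theorem VField.SmoothOn.sum {ι : Type*} {s : Finset ι} {X : ι → VField n M}
    (hX : ∀ i ∈ s, (X i).SmoothOn U) : VField.SmoothOn (∑ i ∈ s, X i) U := by
  have := ContMDiffOn.sum_section (I := 𝓡 n) (n := ∞) (u := U) hX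
  refine this.congr fun y _ ↦ ?_
  simp

theorem VField.SmoothOn.congr (hX : X.SmoothOn U) (h : ∀ x ∈ U, Y x = X x) : Y.SmoothOn U :=
  ContMDiffOn.congr hX fun y hy ↦ by simp [h y hy]

theorem VField.DiffAt.add (hX : X.DiffAt x) (hY : Y.DiffAt x) : (X + Y).DiffAt x :=
  mdifferentiableAt_add_section hX hY

theorem VField.DiffAt.smul (hX : X.DiffAt x) (hf : DiffFunAt (n := n) f x) :
    VField.DiffAt (f • X) x :=
  MDifferentiableAt.smul_section hf hX

theorem VField.DiffAt.sum {ι : Type*} {s : Finset ι} {X : ι → VField n M}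
    (hX : ∀ i ∈ s, (X i).DiffAt x) : VField.DiffAt (∑ i ∈ s, X i) x := by
  have := MDifferentiableAt.sum_section (I := 𝓡 n) (x₀ := x) hX
  refine this.congr_of_eventuallyEq (Filter.Eventually.of_forall fun y ↦ ?_)
  simp

/-- The Leibniz rule applied twice. The inner bracket has to be expanded on a neighbourhood of `x`,
hence smoothness on an open set and not only at `x`. The second-order term in `f` is what the Jacobi
identity converts into the derivative along `[X, Y]`. -/
theorem mlieBracket_mlieBracket_smul (hU : IsOpen U) (hx : x ∈ U)
    (hY : Y.SmoothOn U) (hZ : Z.SmoothOn U) (hf : SmoothFunOn (n := n) f U) :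
    VectorField.mlieBracket (𝓡 n) X (VectorField.mlieBracket (𝓡 n) Y (f • Z)) x =
      dirDeriv X (dirDeriv Y f) x • Z x + dirDeriv Y f x • VectorField.mlieBracket (𝓡 n) X Z x +
      (dirDeriv X f x • VectorField.mlieBracket (𝓡 n) Y Z x +
        f x • VectorField.mlieBracket (𝓡 n) X (VectorField.mlieBracket (𝓡 n) Y Z) x) := by
  have key : VectorField.mlieBracket (𝓡 n) Y (f • Z) =ᶠ[𝓝 x]
      (dirDeriv Y f • Z + f • VectorField.mlieBracket (𝓡 n) Y Z : VField n M) := by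
    filter_upwards [hU.mem_nhds hx] with y hy
    exact VectorField.mlieBracket_smul_right (hf.diffFunAt hU hy) (hZ.diffAt hU hy)
  have hYf := SmoothFunOn.diffFunAt (hY.dirDeriv hf hU) hU hx
  have hYZ := (hY.mlieBracket hZ hU).diffAt hU hx
  have hf' := SmoothFunOn.diffFunAt hf hU hx
  have hZ' := hZ.diffAt hU hx
  refine (Filter.EventuallyEq.mlieBracket_vectorField_eq (Filter.EventuallyEq.refl _ X) key).trans
    ?_
  rw [VectorField.mlieBracket_add_right (hZ'.smul hYf) (hYZ.smul hf'),
    VectorField.mlieBracket_smul_right hYf hZ', VectorField.mlieBracket_smul_right hf' hYZ]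
  rfl

/-- `[X, Y] f = X (Y f) - Y (X f)`, tested against a third vector field. -/
theorem dirDeriv_mlieBracket_smul (hU : IsOpen U) (hx : x ∈ U) (hX : X.SmoothOn U)
    (hY : Y.SmoothOn U) (hZ : Z.SmoothOn U) (hf : SmoothFunOn (n := n) f U) :
    dirDeriv (VectorField.mlieBracket (𝓡 n) X Y) f x • Z x =
      (dirDeriv X (dirDeriv Y f) x - dirDeriv Y (dirDeriv X f) x) • Z x := by
  have : IsManifold (𝓡 n) (minSmoothness ℝ 3) M := by simp; infer_instance
  have h2 {W : VField n M} (hW : W.SmoothOn U) : ContMDiffAt (𝓡 n) (𝓡 n).tangent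
      (minSmoothness ℝ 2) (fun y ↦ (⟨y, W y⟩ : TangentBundle (𝓡 n) M)) x :=
    ((hW x hx).contMDiffAt (hU.mem_nhds hx)).of_le (by simp; exact ENat.LEInfty.out)
  -- Jacobi for `X, Y, fZ` minus `f` times Jacobi for `X, Y, Z`: the first-order cross terms cancel
  -- and only multiples of `Z` remain.
  have J := VectorField.leibniz_identity_mlieBracket_apply (h2 hX) (h2 hY) (h2 (hZ.smul hf))
  have J' := VectorField.leibniz_identity_mlieBracket_apply (h2 hX) (h2 hY) (h2 hZ)
  rw [mlieBracket_mlieBracket_smul hU hx hY hZ hf, mlieBracket_mlieBracket_smul hU hx hX hZ hf,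
    VectorField.mlieBracket_smul_right (hf.diffFunAt hU hx) (hZ.diffAt hU hx), J'] at J
  rw [dirDeriv]
  linear_combination (norm := module) -J

end VectorFieldCalculus

/-! ### Linearity of the Koszul expression in its three arguments. -/

section LeviCivita

variable {n : ℕ} {M : Type*} [TopologicalSpace M]
  [ChartedSpace (EuclideanSpace ℝ (Fin n)) M] [IsManifold (𝓡 n) ∞ M]

namespace PseudoRiemannianMetric

variable {g : PseudoRiemannianMetric n M} {X Y Z X' Y' Z' W : VField n M} {f : M → ℝ} {x : M}
  {U : Set M}

theorem pairing_add_left : g.pairing (X + Y) Z = g.pairing X Z + g.pairing Y Z := by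
  funext x; simp [pairing]

theorem pairing_add_right : g.pairing Z (X + Y) = g.pairing Z X + g.pairing Z Y := by
  funext x; simp [pairing]

theorem pairing_smul_left : g.pairing (f • X) Z = f * g.pairing X Z := by
  funext x; simp [pairing]

theorem pairing_smul_right : g.pairing Z (f • X) = f * g.pairing Z X := by
  funext x; simp [pairing]

theorem pairing_congr (hX : X =ᶠ[𝓝 x] X') (hY : Y =ᶠ[𝓝 x] Y') :
    g.pairing X Y =ᶠ[𝓝 x] g.pairing X' Y' := by
  filter_upwards [hX, hY] with y h1 h2
  rw [pairing, pairing, h1, h2]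

theorem diffFunAt_pairing (hX : X.DiffAt x) (hY : Y.DiffAt x) :
    DiffFunAt (n := n) (g.pairing X Y) x := by
  have hg : MDifferentiableAt (𝓡 n)
    ((𝓡 n).prod 𝓘(ℝ, EuclideanSpace ℝ (Fin n) →L[ℝ] EuclideanSpace ℝ (Fin n) →L[ℝ] ℝ))
    (fun x ↦ TotalSpace.mk' (EuclideanSpace ℝ (Fin n) →L[ℝ] EuclideanSpace ℝ (Fin n) →L[ℝ] ℝ)
      (E := fun x ↦ TangentSpace (𝓡 n) x →L[ℝ] TangentSpace (𝓡 n) x →L[ℝ] ℝ) x (g.form x)) x :=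
    (g.contMDiff x).mdifferentiableAt (by simp)
  have : MDifferentiableAt (𝓡 n) ((𝓡 n).prod 𝓘(ℝ))
      (fun m ↦ TotalSpace.mk' ℝ (E := Bundle.Trivial M ℝ) m (g.form m (X m) (Y m))) x :=
    MDifferentiableAt.clm_bundle_apply₂ (F₁ := EuclideanSpace ℝ (Fin n))
      (F₂ := EuclideanSpace ℝ (Fin n)) hg hX hY
  simp only [mdifferentiableAt_totalSpace] at this
  exact this.2

theorem smoothFunOn_pairing (hX : X.SmoothOn U) (hY : Y.SmoothOn U) :
    SmoothFunOn (n := n) (g.pairing X Y) U := by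
  have : ContMDiffOn (𝓡 n) ((𝓡 n).prod 𝓘(ℝ)) ∞
      (fun m ↦ TotalSpace.mk' ℝ (E := Bundle.Trivial M ℝ) m (g.form m (X m) (Y m))) U :=
    ContMDiffOn.clm_bundle_apply₂ (F₁ := EuclideanSpace ℝ (Fin n))
      (F₂ := EuclideanSpace ℝ (Fin n)) g.contMDiff.contMDiffOn hX hY
  intro y hy
  have h := this y hy
  simp only [contMDiffWithinAt_totalSpace] at h
  exact h.2

theorem koszul_congr (hX : X =ᶠ[𝓝 x] X') (hY : Y =ᶠ[𝓝 x] Y') (hZ : Z =ᶠ[𝓝 x] Z') :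
    g.koszul X Y Z x = g.koszul X' Y' Z' x := by
  simp only [koszul, pairing, hX.self_of_nhds, hY.self_of_nhds, hZ.self_of_nhds,
    dirDeriv_congr hX.self_of_nhds (pairing_congr hY hZ),
    dirDeriv_congr hY.self_of_nhds (pairing_congr hZ hX),
    dirDeriv_congr hZ.self_of_nhds (pairing_congr hX hY),
    hX.mlieBracket_vectorField_eq hY, hX.mlieBracket_vectorField_eq hZ,
    hY.mlieBracket_vectorField_eq hZ]

theorem koszul_add_left (hX : X.DiffAt x) (hX' : X'.DiffAt x) (hY : Y.DiffAt x)
    (hZ : Z.DiffAt x) :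
    g.koszul (X + X') Y Z x = g.koszul X Y Z x + g.koszul X' Y Z x := by
  simp only [koszul, pairing_add_left, pairing_add_right, dirDeriv_add_left, Pi.add_apply,
    dirDeriv_add (diffFunAt_pairing hZ hX) (diffFunAt_pairing hZ hX'),
    dirDeriv_add (diffFunAt_pairing hX hY) (diffFunAt_pairing hX' hY)]
  simp only [pairing, VectorField.mlieBracket_add_left hX hX', map_add,
    add_apply]
  ring

theorem koszul_add_middle (hX : X.DiffAt x) (hY : Y.DiffAt x) (hY' : Y'.DiffAt x)
    (hZ : Z.DiffAt x) :
    g.koszul X (Y + Y') Z x = g.koszul X Y Z x + g.koszul X Y' Z x := by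
  simp only [koszul, pairing_add_left, pairing_add_right, dirDeriv_add_left, Pi.add_apply,
    dirDeriv_add (diffFunAt_pairing hX hY) (diffFunAt_pairing hX hY'),
    dirDeriv_add (diffFunAt_pairing hY hZ) (diffFunAt_pairing hY' hZ)]
  simp only [pairing, VectorField.mlieBracket_add_left hY hY',
    VectorField.mlieBracket_add_right hY hY', map_add,
    add_apply]
  ring

theorem koszul_add_right (hX : X.DiffAt x) (hY : Y.DiffAt x) (hZ : Z.DiffAt x)
    (hZ' : Z'.DiffAt x) :
    g.koszul X Y (Z + Z') x = g.koszul X Y Z x + g.koszul X Y Z' x := by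
  simp only [koszul, pairing_add_left, pairing_add_right, dirDeriv_add_left, Pi.add_apply,
    dirDeriv_add (diffFunAt_pairing hY hZ) (diffFunAt_pairing hY hZ'),
    dirDeriv_add (diffFunAt_pairing hZ hX) (diffFunAt_pairing hZ' hX)]
  simp only [pairing, VectorField.mlieBracket_add_right hZ hZ', map_add,
    add_apply]
  ring

/-- The derivatives of `f` produced by the metric terms cancel against those produced by the
brackets, up to symmetry of `g`. The same happens in the third slot. -/
theorem koszul_smul_left (hf : DiffFunAt (n := n) f x) (hX : X.DiffAt x) (hY : Y.DiffAt x)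
    (hZ : Z.DiffAt x) :
    g.koszul (f • X) Y Z x = f x * g.koszul X Y Z x := by
  simp only [koszul, pairing_smul_left, pairing_smul_right, dirDeriv_smul_left,
    dirDeriv_mul hf (diffFunAt_pairing hZ hX), dirDeriv_mul hf (diffFunAt_pairing hX hY)]
  simp only [pairing, VectorField.mlieBracket_smul_left hf hX, map_add, map_smul, map_neg,
    add_apply, smul_apply, neg_apply,
    smul_eq_mul, dirDeriv, Pi.mul_apply, neg_smul]
  rw [g.symm x (Z x) (X x)]
  ring

/-- In the differentiated slot the `X f` terms add up instead of cancelling; this is the Leibniz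
rule of the connection, with the factor 2 of Koszul's formula. -/
theorem koszul_smul_middle (hf : DiffFunAt (n := n) f x) (hX : X.DiffAt x) (hY : Y.DiffAt x)
    (hZ : Z.DiffAt x) :
    g.koszul X (f • Y) Z x =
      f x * g.koszul X Y Z x + 2 * (dirDeriv X f x * g.form x (Y x) (Z x)) := by
  simp only [koszul, pairing_smul_left, pairing_smul_right, dirDeriv_smul_left,
    dirDeriv_mul hf (diffFunAt_pairing hY hZ), dirDeriv_mul hf (diffFunAt_pairing hX hY)]
  simp only [pairing, VectorField.mlieBracket_smul_left hf hY,
    VectorField.mlieBracket_smul_right hf hY, map_add, map_smul, map_neg,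
    add_apply, smul_apply, neg_apply,
    smul_eq_mul, dirDeriv, Pi.mul_apply, neg_smul]
  rw [g.symm x (Y x) (X x)]
  ring

theorem koszul_smul_right (hf : DiffFunAt (n := n) f x) (hX : X.DiffAt x) (hY : Y.DiffAt x)
    (hZ : Z.DiffAt x) :
    g.koszul X Y (f • Z) x = f x * g.koszul X Y Z x := by
  simp only [koszul, pairing_smul_left, pairing_smul_right, dirDeriv_smul_left,
    dirDeriv_mul hf (diffFunAt_pairing hY hZ), dirDeriv_mul hf (diffFunAt_pairing hZ hX)]
  simp only [pairing,
    VectorField.mlieBracket_smul_right hf hZ, map_add, map_smul,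
    add_apply, smul_apply,
    smul_eq_mul, dirDeriv, Pi.mul_apply]
  rw [g.symm x (Z x) (X x), g.symm x (Z x) (Y x)]
  ring

end PseudoRiemannianMetric
end LeviCivita

/-! ### Existence, linearity and smoothness of the Levi-Civita derivative via a frame. -/

section LeviCivitaFrame

variable {n : ℕ} {M : Type*} [TopologicalSpace M]
  [ChartedSpace (EuclideanSpace ℝ (Fin n)) M] [IsManifold (𝓡 n) ∞ M]

namespace PseudoRiemannianMetric

variable {g : PseudoRiemannianMetric n M} {η : Matrix (Fin n) (Fin n) ℝ}
  {e : Fin n → VField n M} {X Y Z X' Y' W : VField n M} {f : M → ℝ} {x : M} {U V : Set M}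

/-- The chosen vector depends only on the predicate `IsLeviCivitaValue`, which sees only the germs
of the two fields. Neither uniqueness nor differentiability is needed, so the default value 0 causes
no trouble. -/
theorem leviCivita_congr (hX : X =ᶠ[𝓝 x] X') (hY : Y =ᶠ[𝓝 x] Y') :
    g.leviCivita X Y x = g.leviCivita X' Y' x := by
  have : g.IsLeviCivitaValue X Y x = g.IsLeviCivitaValue X' Y' x := by
    funext v
    have h (Z : VField n M) : g.koszul X Y Z x = g.koszul X' Y' Z x :=
      koszul_congr hX hY (Filter.EventuallyEq.refl _ Z)
    simp only [IsLeviCivitaValue, h]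
  rw [leviCivita, leviCivita]
  generalize g.IsLeviCivitaValue X Y x = P at this ⊢
  subst this
  rfl

namespace IsOrthogonalFrameOn

variable (he : g.IsOrthogonalFrameOn η e U)
include he

theorem mono (hV : IsOpen V) (h : V ⊆ U) : g.IsOrthogonalFrameOn η e V :=
  ⟨hV, he.isLocalFrame.mono h, fun x hx ↦ he.orthogonal x (h hx)⟩

theorem smoothOn (a : Fin n) : (e a).SmoothOn U := he.isLocalFrame.contMDiffOn a

theorem diffAt (hx : x ∈ U) (a : Fin n) : (e a).DiffAt x := (he.smoothOn a).diffAt he.isOpen hx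

theorem ext_form (hx : x ∈ U) {v w : TangentSpace (𝓡 n) x}
    (h : ∀ a, g.form x v (e a x) = g.form x w (e a x)) : v = w := by
  rw [← sub_eq_zero]
  refine g.nondegenerate x _ fun u ↦ ?_
  rw [← (he.isLocalFrame.toBasisAt hx).sum_repr u]
  simp [h]

/-- Raising an index with `η⁻¹` gives coefficients in terms of `g`, so that their smoothness follows
from that of the metric. -/
theorem eq_sum (hdet : IsUnit η.det) (hx : x ∈ U) (v : TangentSpace (𝓡 n) x) :
    v = ∑ b, (∑ c, η⁻¹ c b * g.form x v (e c x)) • e b x := by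
  refine he.ext_form hx fun a ↦ ?_
  simp only [map_sum, map_smul, sum_apply, smul_apply, he.orthogonal x hx, smul_eq_mul,
    Finset.sum_mul]
  rw [Finset.sum_comm]
  have h1 : ∀ c, ∑ b, η⁻¹ c b * η b a = (1 : Matrix (Fin n) (Fin n) ℝ) c a := fun c ↦ by
    rw [← Matrix.nonsing_inv_mul η hdet, Matrix.mul_apply]
  have h2 : ∀ c, ∑ b, η⁻¹ c b * g.form x v (e c x) * η b a =
      (1 : Matrix (Fin n) (Fin n) ℝ) c a * g.form x v (e c x) := fun c ↦ by
    rw [← h1, Finset.sum_mul]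
    exact Finset.sum_congr rfl fun b _ ↦ by ring
  simp [h2, Matrix.one_apply]

theorem eq_sum_field (hdet : IsUnit η.det) (hx : x ∈ U) (X : VField n M) :
    X x = (∑ b, (fun y ↦ ∑ c, η⁻¹ c b * g.pairing X (e c) y) • e b : VField n M) x := by
  rw [Finset.sum_apply]
  exact he.eq_sum hdet hx (X x)

theorem diffFunAt_coeff (hx : x ∈ U) (hX : X.DiffAt x) (b : Fin n) :
    DiffFunAt (n := n) (fun y ↦ ∑ c, η⁻¹ c b * g.pairing X (e c) y) x := by
  have h (s : Finset (Fin n)) :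
      DiffFunAt (n := n) (fun y ↦ ∑ c ∈ s, η⁻¹ c b * g.pairing X (e c) y) x := by
    induction s using Finset.induction_on with
    | empty => simpa using mdifferentiableAt_const
    | insert a s ha ih =>
      simp only [Finset.sum_insert ha]
      exact (mdifferentiableAt_const.mul (diffFunAt_pairing hX (he.diffAt hx a))).add ih
  exact h _

theorem smoothFunOn_coeff (hX : X.SmoothOn U) (b : Fin n) :
    SmoothFunOn (n := n) (fun y ↦ ∑ c, η⁻¹ c b * g.pairing X (e c) y) U :=
  contMDiffOn_finsetSum fun c _ ↦
    contMDiffOn_const.mul (smoothFunOn_pairing hX (he.smoothOn c))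

omit he in
theorem koszul_sum_right {ι : Type*} {s : Finset ι} {Z : ι → VField n M} (hX : X.DiffAt x)
    (hY : Y.DiffAt x) (hZ : ∀ i ∈ s, (Z i).DiffAt x) :
    g.koszul X Y (∑ i ∈ s, Z i) x = ∑ i ∈ s, g.koszul X Y (Z i) x := by
  classical
  induction s using Finset.induction_on with
  | empty =>
    -- Additivity at 0 + 0 forces the value at the zero field to vanish; the differentiability of
    -- that field is obtained as that of an empty sum.
    have h := koszul_add_right (g := g) (Z := 0) (Z' := 0) hX hY (VField.DiffAt.sum (s := ∅)
      (X := fun _ : ι ↦ 0) (by simp)) (VField.DiffAt.sum (s := ∅) (X := fun _ : ι ↦ 0) (by simp))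
    simp only [add_zero] at h
    simpa using h
  | insert a s ha ih =>
    rw [Finset.sum_insert ha, Finset.sum_insert ha, koszul_add_right hX hY
      (hZ _ (Finset.mem_insert_self _ _))
      (VField.DiffAt.sum fun i hi ↦ hZ _ (Finset.mem_insert_of_mem hi)),
      ih fun i hi ↦ hZ _ (Finset.mem_insert_of_mem hi)]

/-- Koszul's formula is linear over functions in `Z`, so it suffices to satisfy it on the frame. The
witness is half the Koszul values on the frame with the index raised. -/
theorem isLeviCivitaValue (hdet : IsUnit η.det) (hx : x ∈ U) (hX : X.DiffAt x) (hY : Y.DiffAt x) :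
    g.IsLeviCivitaValue X Y x (g.leviCivita X Y x) := by
  suffices h : ∃ v, g.IsLeviCivitaValue X Y x v by
    rw [leviCivita, dif_pos h]
    exact h.choose_spec
  refine ⟨∑ b, (∑ c, η⁻¹ b c * (g.koszul X Y (e c) x / 2)) • e b x, fun Z hZ ↦ ?_⟩
  have hZ' : Z =ᶠ[𝓝 x] (∑ b, (fun y ↦ ∑ c, η⁻¹ c b * g.pairing Z (e c) y) • e b : VField n M) := by
    filter_upwards [he.isOpen.mem_nhds hx] with y hy using he.eq_sum_field hdet hy Z
  rw [koszul_congr (Filter.EventuallyEq.refl _ X) (Filter.EventuallyEq.refl _ Y) hZ',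
    koszul_sum_right hX hY fun b _ ↦ (he.diffAt hx b).smul (he.diffFunAt_coeff hx hZ b)]
  simp only [koszul_smul_right (he.diffFunAt_coeff hx hZ _) hX hY (he.diffAt hx _)]
  simp only [map_sum, map_smul, sum_apply, smul_apply, smul_eq_mul, Finset.sum_mul,
    Finset.mul_sum]
  rw [Finset.sum_comm]
  refine Finset.sum_congr rfl fun b _ ↦ Finset.sum_congr rfl fun c _ ↦ ?_
  rw [pairing, g.symm x (Z x)]
  ring

theorem form_leviCivita (hdet : IsUnit η.det) (hx : x ∈ U) (hX : X.DiffAt x) (hY : Y.DiffAt x)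
    (a : Fin n) : g.form x (g.leviCivita X Y x) (e a x) = g.koszul X Y (e a) x / 2 := by
  rw [← he.isLeviCivitaValue hdet hx hX hY (e a) (he.diffAt hx a)]
  ring

theorem leviCivita_add_left (hdet : IsUnit η.det) (hx : x ∈ U) (hX : X.DiffAt x)
    (hX' : X'.DiffAt x) (hY : Y.DiffAt x) :
    g.leviCivita (X + X') Y x = g.leviCivita X Y x + g.leviCivita X' Y x := by
  refine he.ext_form hx fun a ↦ ?_
  rw [map_add, add_apply, he.form_leviCivita hdet hx (hX.add hX') hY,
    he.form_leviCivita hdet hx hX hY, he.form_leviCivita hdet hx hX' hY,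
    koszul_add_left hX hX' hY (he.diffAt hx a), add_div]

theorem leviCivita_add_right (hdet : IsUnit η.det) (hx : x ∈ U) (hX : X.DiffAt x)
    (hY : Y.DiffAt x) (hY' : Y'.DiffAt x) :
    g.leviCivita X (Y + Y') x = g.leviCivita X Y x + g.leviCivita X Y' x := by
  refine he.ext_form hx fun a ↦ ?_
  rw [map_add, add_apply, he.form_leviCivita hdet hx hX (hY.add hY'),
    he.form_leviCivita hdet hx hX hY, he.form_leviCivita hdet hx hX hY',
    koszul_add_middle hX hY hY' (he.diffAt hx a), add_div]

theorem leviCivita_smul_left (hdet : IsUnit η.det) (hx : x ∈ U) (hf : DiffFunAt (n := n) f x)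
    (hX : X.DiffAt x) (hY : Y.DiffAt x) :
    g.leviCivita (f • X) Y x = f x • g.leviCivita X Y x := by
  refine he.ext_form hx fun a ↦ ?_
  rw [map_smul, smul_apply, he.form_leviCivita hdet hx (hX.smul hf) hY,
    he.form_leviCivita hdet hx hX hY, koszul_smul_left hf hX hY (he.diffAt hx a), smul_eq_mul,
    mul_div_assoc]

theorem leviCivita_smul_right (hdet : IsUnit η.det) (hx : x ∈ U) (hf : DiffFunAt (n := n) f x)
    (hX : X.DiffAt x) (hY : Y.DiffAt x) :
    g.leviCivita X (f • Y) x = dirDeriv X f x • Y x + f x • g.leviCivita X Y x := by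
  refine he.ext_form hx fun a ↦ ?_
  rw [map_add, map_smul, map_smul, add_apply, smul_apply, smul_apply,
    he.form_leviCivita hdet hx hX (hY.smul hf),
    he.form_leviCivita hdet hx hX hY, koszul_smul_middle hf hX hY (he.diffAt hx a), smul_eq_mul,
    smul_eq_mul]
  ring

theorem smoothFunOn_koszul (hX : X.SmoothOn U) (hY : Y.SmoothOn U) (hZ : Z.SmoothOn U) :
    SmoothFunOn (n := n) (g.koszul X Y Z) U := by
  have hU := he.isOpen
  exact ((((((hX.dirDeriv (smoothFunOn_pairing hY hZ) hU).add
    (hY.dirDeriv (smoothFunOn_pairing hZ hX) hU)).sub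
    (hZ.dirDeriv (smoothFunOn_pairing hX hY) hU)).add
    (smoothFunOn_pairing (hX.mlieBracket hY hU) hZ)).sub
    (smoothFunOn_pairing (hX.mlieBracket hZ hU) hY)).sub
    (smoothFunOn_pairing (hY.mlieBracket hZ hU) hX))

theorem smoothOn_leviCivita (hdet : IsUnit η.det) (hX : X.SmoothOn U) (hY : Y.SmoothOn U) :
    VField.SmoothOn (g.leviCivita X Y) U := by
  have h : VField.SmoothOn
      (∑ b, (fun y ↦ ∑ c, η⁻¹ c b * (g.koszul X Y (e c) y * (1 / 2))) • e b : VField n M) U :=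
    VField.SmoothOn.sum fun b _ ↦ (he.smoothOn b).smul <| contMDiffOn_finsetSum fun c _ ↦
      contMDiffOn_const.mul ((he.smoothFunOn_koszul hX hY (he.smoothOn c)).mul contMDiffOn_const)
  refine h.congr fun x hx ↦ ?_
  rw [he.eq_sum hdet hx (g.leviCivita X Y x), Finset.sum_apply]
  refine Finset.sum_congr rfl fun b _ ↦ ?_
  simp only [Pi.smul_apply', he.form_leviCivita hdet hx (hX.diffAt he.isOpen hx)
    (hY.diffAt he.isOpen hx)]
  congr 1
  exact Finset.sum_congr rfl fun c _ ↦ by ring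

end IsOrthogonalFrameOn
end PseudoRiemannianMetric
end LeviCivitaFrame

/-! ### Smooth tensor fields on an open set; tensoriality of the curvature. -/

section Tensors

variable {n : ℕ} {M : Type*} [TopologicalSpace M]
  [ChartedSpace (EuclideanSpace ℝ (Fin n)) M] [IsManifold (𝓡 n) ∞ M]

/-- On fields smooth on the open set `U`, the operation `T` is a smooth covariant tensor field. -/
structure IsTensorOn {m : ℕ} (T : (Fin m → VField n M) → M → ℝ) (U : Set M) : Prop where
  smooth (X : Fin m → VField n M) (hX : ∀ j, (X j).SmoothOn U) : SmoothFunOn (n := n) (T X) U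
  congr (X Y : Fin m → VField n M) (h : ∀ j, ∀ x ∈ U, X j x = Y j x) :
    ∀ x ∈ U, T X x = T Y x
  add (X : Fin m → VField n M) (hX : ∀ j, (X j).SmoothOn U) (j : Fin m) (Y Z : VField n M)
    (hY : Y.SmoothOn U) (hZ : Z.SmoothOn U) : ∀ x ∈ U,
    T (Function.update X j (Y + Z)) x =
      T (Function.update X j Y) x + T (Function.update X j Z) x
  smul (X : Fin m → VField n M) (hX : ∀ j, (X j).SmoothOn U) (j : Fin m) (f : M → ℝ)
    (Y : VField n M) (hf : SmoothFunOn (n := n) f U) (hY : Y.SmoothOn U) : ∀ x ∈ U,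
    T (Function.update X j (f • Y)) x = f x * T (Function.update X j Y) x

namespace PseudoRiemannianMetric

variable {g : PseudoRiemannianMetric n M} {η : Matrix (Fin n) (Fin n) ℝ}
  {e : Fin n → VField n M} {X Y Z W X' Y' Z' W' : VField n M} {f : M → ℝ} {x : M} {U V : Set M}

theorem riemann_add_last :
    g.riemann X Y Z (W + W') x = g.riemann X Y Z W x + g.riemann X Y Z W' x := by
  simp only [riemann, Pi.add_apply, map_add]

theorem riemann_smul_last : g.riemann X Y Z (f • W) x = f x * g.riemann X Y Z W x := by
  simp [riemann]

namespace IsOrthogonalFrameOn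

variable (he : g.IsOrthogonalFrameOn η e U)
include he

theorem leviCivita_congr (hx : x ∈ U) (hX : ∀ y ∈ U, X y = X' y) (hY : ∀ y ∈ U, Y y = Y' y) :
    g.leviCivita X Y x = g.leviCivita X' Y' x :=
  PseudoRiemannianMetric.leviCivita_congr
    (Filter.eventuallyEq_of_mem (he.isOpen.mem_nhds hx) hX)
    (Filter.eventuallyEq_of_mem (he.isOpen.mem_nhds hx) hY)

theorem mlieBracket_congr (hx : x ∈ U) (hX : ∀ y ∈ U, X y = X' y) (hY : ∀ y ∈ U, Y y = Y' y) :
    VectorField.mlieBracket (𝓡 n) X Y x = VectorField.mlieBracket (𝓡 n) X' Y' x :=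
  (Filter.eventuallyEq_of_mem (he.isOpen.mem_nhds hx) hX).mlieBracket_vectorField_eq
    (Filter.eventuallyEq_of_mem (he.isOpen.mem_nhds hx) hY)

theorem riemann_congr (hx : x ∈ U) (hX : ∀ y ∈ U, X y = X' y) (hY : ∀ y ∈ U, Y y = Y' y)
    (hZ : ∀ y ∈ U, Z y = Z' y) (hW : ∀ y ∈ U, W y = W' y) :
    g.riemann X Y Z W x = g.riemann X' Y' Z' W' x := by
  rw [riemann, riemann, hW x hx,
    he.leviCivita_congr hx hX fun y hy ↦ he.leviCivita_congr hy hY hZ,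
    he.leviCivita_congr hx hY fun y hy ↦ he.leviCivita_congr hy hX hZ,
    he.leviCivita_congr hx (fun y hy ↦ he.mlieBracket_congr hy hX hY) hZ]

theorem smoothFunOn_riemann (hdet : IsUnit η.det) (hX : X.SmoothOn U) (hY : Y.SmoothOn U)
    (hZ : Z.SmoothOn U) (hW : W.SmoothOn U) : SmoothFunOn (n := n) (g.riemann X Y Z W) U := by
  have h1 := smoothFunOn_pairing (g := g)
    (he.smoothOn_leviCivita hdet hX (he.smoothOn_leviCivita hdet hY hZ)) hW
  have h2 := smoothFunOn_pairing (g := g)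
    (he.smoothOn_leviCivita hdet hY (he.smoothOn_leviCivita hdet hX hZ)) hW
  have h3 := smoothFunOn_pairing (g := g)
    (he.smoothOn_leviCivita hdet (hX.mlieBracket hY he.isOpen) hZ) hW
  refine ((h1.sub h2).sub h3).congr fun y _ ↦ ?_
  simp [riemann, pairing]

theorem leviCivita_neg_left (hdet : IsUnit η.det) (hx : x ∈ U) (hX : X.DiffAt x)
    (hY : Y.DiffAt x) : g.leviCivita (-X) Y x = -g.leviCivita X Y x := by
  have h := he.leviCivita_smul_left hdet hx (f := fun _ ↦ -1) mdifferentiableAt_const hX hY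
  have h' : (fun _ : M ↦ (-1 : ℝ)) • X = -X := by funext y; simp
  rw [← h', h]
  simp

theorem riemann_swap (hdet : IsUnit η.det) (hx : x ∈ U) (hX : X.SmoothOn U) (hY : Y.SmoothOn U)
    (hZ : Z.SmoothOn U) : g.riemann X Y Z W x = -g.riemann Y X Z W x := by
  rw [riemann, riemann, VectorField.mlieBracket_swap, he.leviCivita_neg_left hdet hx
    ((hY.mlieBracket hX he.isOpen).diffAt he.isOpen hx) (hZ.diffAt he.isOpen hx), ← neg_apply,
    ← map_neg]
  congr 2
  abel

theorem riemann_add_first (hdet : IsUnit η.det) (hx : x ∈ U) (hX : X.SmoothOn U)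
    (hX' : X'.SmoothOn U) (hY : Y.SmoothOn U) (hZ : Z.SmoothOn U) :
    g.riemann (X + X') Y Z W x = g.riemann X Y Z W x + g.riemann X' Y Z W x := by
  have hU := he.isOpen
  have d {A : VField n M} (hA : A.SmoothOn U) {y} (hy : y ∈ U) : A.DiffAt y := hA.diffAt hU hy
  have s {A B : VField n M} (hA : A.SmoothOn U) (hB : B.SmoothOn U) :
    VField.SmoothOn (g.leviCivita A B) U := he.smoothOn_leviCivita hdet hA hB
  have h1 := he.leviCivita_add_left hdet hx (d hX hx) (d hX' hx) (d (s hY hZ) hx)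
  have h2 : g.leviCivita Y (g.leviCivita (X + X') Z) x =
      g.leviCivita Y (g.leviCivita X Z) x + g.leviCivita Y (g.leviCivita X' Z) x := by
    rw [← he.leviCivita_add_right hdet hx (d hY hx) (d (s hX hZ) hx) (d (s hX' hZ) hx)]
    exact he.leviCivita_congr hx (fun _ _ ↦ rfl) fun y hy ↦
      he.leviCivita_add_left hdet hy (d hX hy) (d hX' hy) (d hZ hy)
  have h3 : g.leviCivita (VectorField.mlieBracket (𝓡 n) (X + X') Y) Z x =
      g.leviCivita (VectorField.mlieBracket (𝓡 n) X Y) Z x +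
        g.leviCivita (VectorField.mlieBracket (𝓡 n) X' Y) Z x := by
    rw [← he.leviCivita_add_left hdet hx (d (hX.mlieBracket hY hU) hx)
      (d (hX'.mlieBracket hY hU) hx) (d hZ hx)]
    exact he.leviCivita_congr hx
      (fun y hy ↦ VectorField.mlieBracket_add_left (d hX hy) (d hX' hy)) fun _ _ ↦ rfl
  rw [riemann, riemann, riemann, h1, h2, h3, ← add_apply, ← map_add]
  congr 2
  abel

/-- The term `(Y f) ∇_X Z` from `∇_Y (f ∇_X Z)` cancels against the one from `[fX, Y] = f [X, Y] -
(Y f) X`. -/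
theorem riemann_smul_first (hdet : IsUnit η.det) (hx : x ∈ U) (hf : SmoothFunOn (n := n) f U)
    (hX : X.SmoothOn U) (hY : Y.SmoothOn U) (hZ : Z.SmoothOn U) :
    g.riemann (f • X) Y Z W x = f x * g.riemann X Y Z W x := by
  have hU := he.isOpen
  have d {A : VField n M} (hA : A.SmoothOn U) {y} (hy : y ∈ U) : A.DiffAt y := hA.diffAt hU hy
  have s {A B : VField n M} (hA : A.SmoothOn U) (hB : B.SmoothOn U) :
    VField.SmoothOn (g.leviCivita A B) U := he.smoothOn_leviCivita hdet hA hB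
  have df {y} (hy : y ∈ U) : DiffFunAt (n := n) f y := hf.diffFunAt hU hy
  have h1 := he.leviCivita_smul_left hdet hx (df hx) (d hX hx) (d (s hY hZ) hx)
  have h2 : g.leviCivita Y (g.leviCivita (f • X) Z) x =
      dirDeriv Y f x • g.leviCivita X Z x + f x • g.leviCivita Y (g.leviCivita X Z) x := by
    rw [← he.leviCivita_smul_right hdet hx (df hx) (d hY hx) (d (s hX hZ) hx)]
    exact he.leviCivita_congr hx (fun _ _ ↦ rfl) fun y hy ↦
      he.leviCivita_smul_left hdet hy (df hy) (d hX hy) (d hZ hy)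
  have hYf : SmoothFunOn (n := n) (fun y ↦ -dirDeriv Y f y) U := (hY.dirDeriv hf hU).neg
  have h3 : g.leviCivita (VectorField.mlieBracket (𝓡 n) (f • X) Y) Z x =
      -dirDeriv Y f x • g.leviCivita X Z x +
        f x • g.leviCivita (VectorField.mlieBracket (𝓡 n) X Y) Z x := by
    have hXY := hX.mlieBracket hY hU
    rw [← he.leviCivita_smul_left hdet hx (df hx) (d hXY hx) (d hZ hx),
      ← he.leviCivita_smul_left hdet hx (hYf.diffFunAt hU hx) (d hX hx) (d hZ hx),
      ← he.leviCivita_add_left hdet hx (d (hX.smul hYf) hx) (d (hXY.smul hf) hx) (d hZ hx)]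
    exact he.leviCivita_congr hx
      (fun y hy ↦ VectorField.mlieBracket_smul_left (df hy) (d hX hy)) fun _ _ ↦ rfl
  rw [riemann, riemann, h1, h2, h3, ← smul_eq_mul, ← smul_apply, ← map_smul]
  congr 2
  module

theorem riemann_add_third (hdet : IsUnit η.det) (hx : x ∈ U) (hX : X.SmoothOn U)
    (hY : Y.SmoothOn U) (hZ : Z.SmoothOn U) (hZ' : Z'.SmoothOn U) :
    g.riemann X Y (Z + Z') W x = g.riemann X Y Z W x + g.riemann X Y Z' W x := by
  have hU := he.isOpen
  have d {A : VField n M} (hA : A.SmoothOn U) {y} (hy : y ∈ U) : A.DiffAt y := hA.diffAt hU hy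
  have s {A B : VField n M} (hA : A.SmoothOn U) (hB : B.SmoothOn U) :
    VField.SmoothOn (g.leviCivita A B) U := he.smoothOn_leviCivita hdet hA hB
  have h1 {A B : VField n M} (hA : A.SmoothOn U) (hB : B.SmoothOn U) :
      g.leviCivita A (g.leviCivita B (Z + Z')) x =
      g.leviCivita A (g.leviCivita B Z) x + g.leviCivita A (g.leviCivita B Z') x := by
    rw [← he.leviCivita_add_right hdet hx (d hA hx) (d (s hB hZ) hx) (d (s hB hZ') hx)]
    exact he.leviCivita_congr hx (fun _ _ ↦ rfl) fun y hy ↦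
      he.leviCivita_add_right hdet hy (d hB hy) (d hZ hy) (d hZ' hy)
  rw [riemann, riemann, riemann, h1 hX hY, h1 hY hX, he.leviCivita_add_right hdet hx
    (d (hX.mlieBracket hY hU) hx) (d hZ hx) (d hZ' hx), ← add_apply, ← map_add]
  congr 2
  abel

/-- First derivatives of `f` cancel by symmetry in the two orders of differentiation; the second
derivatives leave `X (Y f) - Y (X f)`, which `∇_[X,Y]` removes through `dirDeriv_mlieBracket_smul`.
-/
theorem riemann_smul_third (hdet : IsUnit η.det) (hx : x ∈ U) (hf : SmoothFunOn (n := n) f U)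
    (hX : X.SmoothOn U) (hY : Y.SmoothOn U) (hZ : Z.SmoothOn U) :
    g.riemann X Y (f • Z) W x = f x * g.riemann X Y Z W x := by
  have hU := he.isOpen
  have d {A : VField n M} (hA : A.SmoothOn U) {y} (hy : y ∈ U) : A.DiffAt y := hA.diffAt hU hy
  have s {A B : VField n M} (hA : A.SmoothOn U) (hB : B.SmoothOn U) :
    VField.SmoothOn (g.leviCivita A B) U := he.smoothOn_leviCivita hdet hA hB
  have df {y} (hy : y ∈ U) : DiffFunAt (n := n) f y := hf.diffFunAt hU hy
  have h1 {A B : VField n M} (hA : A.SmoothOn U) (hB : B.SmoothOn U) :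
      g.leviCivita A (g.leviCivita B (f • Z)) x =
      (dirDeriv A (dirDeriv B f) x • Z x + dirDeriv B f x • g.leviCivita A Z x) +
      (dirDeriv A f x • g.leviCivita B Z x + f x • g.leviCivita A (g.leviCivita B Z) x) := by
    have hBf : SmoothFunOn (n := n) (dirDeriv B f) U := hB.dirDeriv hf hU
    rw [← he.leviCivita_smul_right hdet hx (df hx) (d hA hx) (d (s hB hZ) hx),
      ← he.leviCivita_smul_right hdet hx (hBf.diffFunAt hU hx) (d hA hx) (d hZ hx),
      ← he.leviCivita_add_right hdet hx (d hA hx) (d (hZ.smul hBf) hx)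
        (d ((s hB hZ).smul hf) hx)]
    exact he.leviCivita_congr hx (fun _ _ ↦ rfl) fun y hy ↦
      he.leviCivita_smul_right hdet hy (df hy) (d hB hy) (d hZ hy)
  rw [riemann, riemann, h1 hX hY, h1 hY hX, he.leviCivita_smul_right hdet hx (df hx)
    (d (hX.mlieBracket hY hU) hx) (d hZ hx), dirDeriv_mlieBracket_smul hU hx hX hY hZ hf,
    ← smul_eq_mul, ← smul_apply, ← map_smul]
  congr 2
  module

theorem isTensorOn_riemann (hdet : IsUnit η.det) :
    IsTensorOn (fun X : Fin 4 → VField n M ↦ g.riemann (X 0) (X 1) (X 2) (X 3)) U where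
  smooth X hX := he.smoothFunOn_riemann hdet (hX _) (hX _) (hX _) (hX _)
  congr X Y h x hx := he.riemann_congr hx (h _) (h _) (h _) (h _)
  add X hX j Y Z hY hZ x hx := by
    fin_cases j
    · simpa [Function.update] using he.riemann_add_first hdet hx hY hZ (hX 1) (hX 2)
    · simp only [Function.update, Fin.mk_one, eq_rec_constant, dite_eq_ite, zero_ne_one, if_false,
        if_true]
      simp
      -- Antisymmetry reduces the second slot to the first.
      rw [he.riemann_swap hdet hx (hX 0) (hY.add hZ) (hX 2),
        he.riemann_swap hdet hx (hX 0) hY (hX 2), he.riemann_swap hdet hx (hX 0) hZ (hX 2), he.riemann_add_first hdet hx hY hZ (hX 0) (hX 2)]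
      ring
    · simpa [Function.update] using he.riemann_add_third hdet hx (hX 0) (hX 1) hY hZ
    · simpa [Function.update] using riemann_add_last
  smul X hX j f Y hf hY x hx := by
    fin_cases j
    · simpa [Function.update] using he.riemann_smul_first hdet hx hf hY (hX 1) (hX 2)
    · simp only [Function.update, Fin.mk_one, eq_rec_constant, dite_eq_ite, zero_ne_one, if_false,
        if_true]
      simp
      rw [he.riemann_swap hdet hx (hX 0) (hY.smul hf) (hX 2),
        he.riemann_swap hdet hx (hX 0) hY (hX 2), he.riemann_smul_first hdet hx hf hY (hX 0) (hX 2)]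
      ring
    · simpa [Function.update] using he.riemann_smul_third hdet hx hf (hX 0) (hX 1) hY
    · simpa [Function.update] using riemann_smul_last

end IsOrthogonalFrameOn
end PseudoRiemannianMetric
end Tensors

/-! ### Tensoriality of the iterated covariant derivatives. -/

section CovariantDerivatives

variable {n : ℕ} {M : Type*} [TopologicalSpace M]
  [ChartedSpace (EuclideanSpace ℝ (Fin n)) M] [IsManifold (𝓡 n) ∞ M]

namespace PseudoRiemannianMetric

variable {g : PseudoRiemannianMetric n M} {η : Matrix (Fin n) (Fin n) ℝ}
  {e : Fin n → VField n M} {f : M → ℝ} {x : M} {U V : Set M}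

omit [IsManifold (𝓡 n) ∞ M] in
theorem dirDeriv_congr_of_isOpen {X Y : VField n M} {f h : M → ℝ} (hU : IsOpen U) (hx : x ∈ U)
    (hX : X x = Y x) (hf : ∀ y ∈ U, f y = h y) : dirDeriv X f x = dirDeriv Y h x :=
  dirDeriv_congr hX (Filter.eventuallyEq_of_mem (hU.mem_nhds hx) hf)

namespace IsOrthogonalFrameOn

variable (he : g.IsOrthogonalFrameOn η e U)
include he

theorem smoothOn_update_leviCivita (hdet : IsUnit η.det) {m : ℕ} {X : Fin m → VField n M}
    (hX : ∀ j, (X j).SmoothOn U) {Y : VField n M} (hY : Y.SmoothOn U) (j k : Fin m) :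
    (Function.update X j (g.leviCivita Y (X j)) k).SmoothOn U := by
  rcases eq_or_ne k j with rfl | h
  · simpa using he.smoothOn_leviCivita hdet hY (hX k)
  · simpa [h] using hX k

omit he in
theorem _root_.VField.SmoothOn.update {m : ℕ} {X : Fin m → VField n M}
    (hX : ∀ j, (X j).SmoothOn U) {Y : VField n M} (hY : Y.SmoothOn U) (j k : Fin m) :
    (Function.update X j Y k).SmoothOn U := by
  rcases eq_or_ne k j with rfl | h
  · simpa using hY
  · simpa [h] using hX k

theorem isTensorOn_covDeriv (hdet : IsUnit η.det) {m : ℕ} {T : (Fin m → VField n M) → M → ℝ}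
    (hT : IsTensorOn T U) : IsTensorOn (g.covDeriv T) U where
  smooth X hX := by
    have hX' (j : Fin m) : (Fin.init X j).SmoothOn U := hX _
    have h1 : SmoothFunOn (n := n) (dirDeriv (X (Fin.last m)) (T (Fin.init X))) U :=
      (hX _).dirDeriv (hT.smooth _ hX') he.isOpen
    refine h1.sub (contMDiffOn_finsetSum fun j _ ↦ hT.smooth _ ?_)
    exact he.smoothOn_update_leviCivita hdet hX' (hX _) j
  congr X Y h x hx := by
    rw [covDeriv, covDeriv, dirDeriv_congr_of_isOpen he.isOpen hx (h _ x hx)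
      (hT.congr (Fin.init X) (Fin.init Y) fun j ↦ h _)]
    congr 1
    refine Finset.sum_congr rfl fun j _ ↦ hT.congr _ _ (fun k y hy ↦ ?_) x hx
    rcases eq_or_ne k j with rfl | hk
    · simp only [Function.update_self]
      exact he.leviCivita_congr hy (h _) (h _)
    · simp only [Function.update_of_ne hk]
      exact h _ y hy
  add X hX j Y Z hY hZ x hx := by
    have hX' (j : Fin m) : (Fin.init X j).SmoothOn U := hX _
    have hU := he.isOpen
    induction j using Fin.lastCases with
    | last =>
      simp only [covDeriv, Fin.init_update_last, Function.update_self, dirDeriv_add_left]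
      have h (j : Fin m) : T (Function.update (Fin.init X) j
          (g.leviCivita (Y + Z) (Fin.init X j))) x =
          T (Function.update (Fin.init X) j (g.leviCivita Y (Fin.init X j))) x +
          T (Function.update (Fin.init X) j (g.leviCivita Z (Fin.init X j))) x := by
        rw [← hT.add _ hX' j _ _ (he.smoothOn_leviCivita hdet hY (hX' j))
          (he.smoothOn_leviCivita hdet hZ (hX' j)) x hx]
        refine hT.congr _ _ (fun k y hy ↦ ?_) x hx
        rcases eq_or_ne k j with rfl | hk
        · simpa using he.leviCivita_add_left hdet hy (hY.diffAt hU hy) (hZ.diffAt hU hy)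
            ((hX' k).diffAt hU hy)
        · simp [hk]
      simp only [h, Finset.sum_add_distrib]
      ring
    | cast i =>
      have hl : Fin.last m ≠ i.castSucc := (Fin.castSucc_lt_last i).ne'
      simp only [covDeriv, Fin.init_update_castSucc, Function.update_of_ne hl]
      have h1 : dirDeriv (X (Fin.last m)) (T (Function.update (Fin.init X) i (Y + Z))) x =
          dirDeriv (X (Fin.last m)) (T (Function.update (Fin.init X) i Y)) x +
          dirDeriv (X (Fin.last m)) (T (Function.update (Fin.init X) i Z)) x := by
        rw [← dirDeriv_add
          (SmoothFunOn.diffFunAt (hT.smooth _ (VField.SmoothOn.update hX' hY i)) hU hx)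
          (SmoothFunOn.diffFunAt (hT.smooth _ (VField.SmoothOn.update hX' hZ i)) hU hx)]
        exact dirDeriv_congr_of_isOpen hU hx rfl (hT.add _ hX' i Y Z hY hZ)
      have h2 (j : Fin m) : T (Function.update (Function.update (Fin.init X) i (Y + Z)) j
          (g.leviCivita (X (Fin.last m)) (Function.update (Fin.init X) i (Y + Z) j))) x =
          T (Function.update (Function.update (Fin.init X) i Y) j
          (g.leviCivita (X (Fin.last m)) (Function.update (Fin.init X) i Y j))) x +
          T (Function.update (Function.update (Fin.init X) i Z) j
          (g.leviCivita (X (Fin.last m)) (Function.update (Fin.init X) i Z j))) x := by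
        rcases eq_or_ne j i with rfl | hj
        · simp only [Function.update_self, Function.update_idem]
          rw [← hT.add _ hX' j _ _ (he.smoothOn_leviCivita hdet (hX _) hY)
            (he.smoothOn_leviCivita hdet (hX _) hZ) x hx]
          refine hT.congr _ _ (fun k y hy ↦ ?_) x hx
          rcases eq_or_ne k j with rfl | hk
          · simpa using he.leviCivita_add_right hdet hy ((hX _).diffAt hU hy) (hY.diffAt hU hy)
              (hZ.diffAt hU hy)
          · simp [hk]
        · simp only [Function.update_of_ne hj, Function.update_comm hj.symm]
          exact hT.add _ (he.smoothOn_update_leviCivita hdet hX' (hX _) j) i Y Z hY hZ x hx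
      simp only [h1, h2, Finset.sum_add_distrib]
      ring
  smul X hX j f Y hf hY x hx := by
    have hX' (j : Fin m) : (Fin.init X j).SmoothOn U := hX _
    have hU := he.isOpen
    have df {y} (hy : y ∈ U) : DiffFunAt (n := n) f y := hf.diffFunAt hU hy
    induction j using Fin.lastCases with
    | last =>
      simp only [covDeriv, Fin.init_update_last, Function.update_self, dirDeriv_smul_left]
      have h (j : Fin m) : T (Function.update (Fin.init X) j
          (g.leviCivita (f • Y) (Fin.init X j))) x =
          f x * T (Function.update (Fin.init X) j (g.leviCivita Y (Fin.init X j))) x := by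
        rw [← hT.smul _ hX' j _ _ hf (he.smoothOn_leviCivita hdet hY (hX' j)) x hx]
        refine hT.congr _ _ (fun k y hy ↦ ?_) x hx
        rcases eq_or_ne k j with rfl | hk
        · simpa using he.leviCivita_smul_left hdet hy (df hy) (hY.diffAt hU hy)
            ((hX' k).diffAt hU hy)
        · simp [hk]
      simp only [h, ← Finset.mul_sum]
      ring
    | cast i =>
      have hl : Fin.last m ≠ i.castSucc := (Fin.castSucc_lt_last i).ne'
      simp only [covDeriv, Fin.init_update_castSucc, Function.update_of_ne hl]
      have hXf : SmoothFunOn (n := n) (dirDeriv (X (Fin.last m)) f) U :=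
        (hX _).dirDeriv hf hU
      have h1 : dirDeriv (X (Fin.last m)) (T (Function.update (Fin.init X) i (f • Y))) x =
          f x * dirDeriv (X (Fin.last m)) (T (Function.update (Fin.init X) i Y)) x +
          T (Function.update (Fin.init X) i Y) x * dirDeriv (X (Fin.last m)) f x := by
        rw [← dirDeriv_mul (df hx)
          (SmoothFunOn.diffFunAt (hT.smooth _ (VField.SmoothOn.update hX' hY i)) hU hx)]
        exact dirDeriv_congr_of_isOpen hU hx rfl (hT.smul _ hX' i f Y hf hY)
      -- Only the slot carrying `f • Y` contributes a derivative of `f`; that term cancels the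
      -- product-rule term of `h1`.
      have h2 (j : Fin m) : T (Function.update (Function.update (Fin.init X) i (f • Y)) j
          (g.leviCivita (X (Fin.last m)) (Function.update (Fin.init X) i (f • Y) j))) x =
          f x * T (Function.update (Function.update (Fin.init X) i Y) j
          (g.leviCivita (X (Fin.last m)) (Function.update (Fin.init X) i Y j))) x +
          if j = i then dirDeriv (X (Fin.last m)) f x * T (Function.update (Fin.init X) i Y) x
            else 0 := by
        rcases eq_or_ne j i with rfl | hj
        · simp only [Function.update_self, Function.update_idem, if_true]
          have hL := he.smoothOn_leviCivita hdet (hX (Fin.last m)) hY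
          rw [← hT.smul _ hX' j _ _ hf hL x hx, ← hT.smul _ hX' j _ _ hXf hY x hx,
            ← hT.add _ hX' j _ _ (hL.smul hf) (hY.smul hXf) x hx]
          refine hT.congr _ _ (fun k y hy ↦ ?_) x hx
          rcases eq_or_ne k j with rfl | hk
          · simpa [add_comm] using he.leviCivita_smul_right hdet hy (df hy)
              ((hX _).diffAt hU hy) (hY.diffAt hU hy)
          · simp [hk]
        · simp only [Function.update_of_ne hj, Function.update_comm hj.symm, if_neg hj, add_zero]
          exact hT.smul _ (he.smoothOn_update_leviCivita hdet hX' (hX _) j) i f Y hf hY x hx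
      simp only [h1, h2, Finset.sum_add_distrib, ← Finset.mul_sum, Finset.sum_ite_eq',
        Finset.mem_univ, if_true]
      ring

theorem isTensorOn_curvatureDeriv (hdet : IsUnit η.det) (i : ℕ) :
    IsTensorOn (g.curvatureDeriv i) U := by
  induction i with
  | zero => exact he.isTensorOn_riemann hdet
  | succ i ih => exact he.isTensorOn_covDeriv hdet ih

end IsOrthogonalFrameOn
end PseudoRiemannianMetric
end CovariantDerivatives

/-! ### Transformation of components under a change of frame. -/

section FrameChange

variable {n : ℕ} {M : Type*} [TopologicalSpace M]
  [ChartedSpace (EuclideanSpace ℝ (Fin n)) M] [IsManifold (𝓡 n) ∞ M]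

/-- The real vector space of vector fields that are smooth on `U`. -/
def smoothFields (n : ℕ) {M : Type*} [TopologicalSpace M]
    [ChartedSpace (EuclideanSpace ℝ (Fin n)) M] [IsManifold (𝓡 n) ∞ M] (U : Set M) :
    Submodule ℝ (VField n M) where
  carrier := {X | X.SmoothOn U}
  add_mem' hX hY := VField.SmoothOn.add hX hY
  zero_mem' := VField.SmoothOn.sum (s := (∅ : Finset ℕ)) (X := fun _ ↦ 0) (by simp)
  smul_mem' c X hX := VField.SmoothOn.smul (f := fun _ ↦ c) hX contMDiffOn_const

namespace IsTensorOn

variable {m : ℕ} {T : (Fin m → VField n M) → M → ℝ} {U : Set M} {x : M}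

/-- A tensor field on `U`, evaluated at `x`, as a multilinear map on the smooth fields. -/
noncomputable def toMultilinearMap (hT : IsTensorOn T U) (hx : x ∈ U) :
    MultilinearMap ℝ (fun _ : Fin m ↦ smoothFields n U) ℝ where
  toFun X := T (fun j ↦ X j) x
  map_update_add' := by
    intro inst X i Y Z
    obtain rfl : inst = instDecidableEqFin m := Subsingleton.elim _ _
    have h (W : smoothFields n U) : (fun j ↦ (Function.update X i W j : VField n M)) =
        Function.update (fun j ↦ (X j : VField n M)) i W := by
      funext j
      rcases eq_or_ne j i with rfl | h <;> simp [*]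
    simp only [h]
    exact hT.add (fun j ↦ X j) (fun j ↦ (X j).2) i Y Z Y.2 Z.2 x hx
  map_update_smul' := by
    intro inst X i c Y
    obtain rfl : inst = instDecidableEqFin m := Subsingleton.elim _ _
    have h (W : smoothFields n U) : (fun j ↦ (Function.update X i W j : VField n M)) =
        Function.update (fun j ↦ (X j : VField n M)) i W := by
      funext j
      rcases eq_or_ne j i with rfl | h <;> simp [*]
    simp only [h]
    exact hT.smul (fun j ↦ X j) (fun j ↦ (X j).2) i (fun _ ↦ c) Y contMDiffOn_const Y.2 x hx

theorem map_sum (hT : IsTensorOn T U) (hx : x ∈ U) (F : Fin m → Fin n → VField n M)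
    (hF : ∀ j b, (F j b).SmoothOn U) :
    T (fun j ↦ ∑ b, F j b) x = ∑ b : Fin m → Fin n, T (fun j ↦ F j (b j)) x := by
  have h := (hT.toMultilinearMap hx).map_sum fun j b ↦ (⟨F j b, hF j b⟩ : smoothFields n U)
  simpa [toMultilinearMap] using h

/-- `toMultilinearMap` is linear only over ℝ, so function coefficients are extracted separately, one
slot at a time. -/
theorem map_smul_univ (hT : IsTensorOn T U) (hx : x ∈ U) (c : Fin m → M → ℝ)
    (X : Fin m → VField n M) (hc : ∀ j, SmoothFunOn (n := n) (c j) U)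
    (hX : ∀ j, (X j).SmoothOn U) : T (fun j ↦ c j • X j) x = (∏ j, c j x) * T X x := by
  have h (s : Finset (Fin m)) :
      T (s.piecewise (fun j ↦ c j • X j) X) x = (∏ j ∈ s, c j x) * T X x := by
    induction s using Finset.induction_on with
    | empty => simp
    | insert a s ha ih =>
      rw [Finset.piecewise_insert, hT.smul _ (fun j ↦ ?_) a _ _ (hc a) (hX a) x hx,
        Finset.prod_insert ha, mul_assoc, ← ih]
      · congr 2
        rw [Function.update_eq_self_iff, Finset.piecewise_eq_of_notMem _ _ _ ha]
      · by_cases hj : j ∈ s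
        · simpa [hj] using (hX j).smul (hc j)
        · simpa [hj] using hX j
  simpa using h Finset.univ

end IsTensorOn

namespace PseudoRiemannianMetric

variable {g : PseudoRiemannianMetric n M} {η : Matrix (Fin n) (Fin n) ℝ}
  {e e' : Fin n → VField n M} {x : M} {U V : Set M}

namespace IsOrthogonalFrameOn

theorem smoothFunOn_components (hdet : IsUnit η.det) (he : g.IsOrthogonalFrameOn η e U) (i : ℕ)
    (a : Fin (4 + i) → Fin n) : SmoothFunOn (n := n) (fun y ↦ g.components e i y a) U :=
  (he.isTensorOn_curvatureDeriv hdet i).smooth _ fun _ ↦ he.smoothOn _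

/-- Two orthogonal frames are related by a transformation in `O(η)` at each point, and the
components of the curvature and its derivatives transform accordingly. -/
theorem exists_components_eq_frameChange (hdet : IsUnit η.det) (he : g.IsOrthogonalFrameOn η e U)
    (he' : g.IsOrthogonalFrameOn η e' U) (hx : x ∈ U) :
    ∃ A ∈ orthogonalGroupOf η, ∀ i,
      g.components e' i x = frameChange (A : Matrix (Fin n) (Fin n) ℝ) (g.components e i x) := by
  set A : Matrix (Fin n) (Fin n) ℝ :=
    .of fun b a ↦ ∑ c, η⁻¹ c b * g.pairing (e' a) (e c) x with hA
  have hsum (a : Fin n) : e' a x = ∑ b, A b a • e b x := he.eq_sum hdet hx (e' a x)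
  have hO : Aᵀ * η * A = η := by
    ext a a'
    rw [← he'.orthogonal x hx a a', hsum a, hsum a']
    simp only [_root_.map_sum, map_smul, sum_apply, smul_apply, he.orthogonal x hx, smul_eq_mul,
      Matrix.mul_apply, Matrix.transpose_apply, Finset.sum_mul, Finset.mul_sum]
    exact Finset.sum_congr rfl fun b _ ↦ Finset.sum_congr rfl fun c _ ↦ by ring
  -- Taking determinants in `Aᵀ η A = η` with `det η ≠ 0`.
  have hA0 : A.det ≠ 0 := fun h0 ↦ by
    have := congrArg Matrix.det hO
    rw [Matrix.det_mul, h0, mul_zero] at this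
    exact hdet.ne_zero this.symm
  refine ⟨Matrix.GeneralLinearGroup.mkOfDetNeZero A hA0, hO, fun i ↦ funext fun a ↦ ?_⟩
  have hT := he.isTensorOn_curvatureDeriv hdet i
  have hc (b a : Fin n) := he.smoothFunOn_coeff (he'.smoothOn a) b
  -- The new frame is expanded with coefficient functions on all of `U`, since `IsTensorOn.congr`
  -- requires agreement on `U` and not merely at `x`.
  have h1 : g.components e' i x a = g.curvatureDeriv i (fun j ↦ ∑ b,
      (fun y ↦ ∑ c, η⁻¹ c b * g.pairing (e' (a j)) (e c) y) • e b) x :=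
    hT.congr _ _ (fun j y hy ↦ he.eq_sum_field hdet hy _) x hx
  rw [h1, hT.map_sum hx _ fun j b ↦ (he.smoothOn b).smul (hc b (a j))]
  exact Finset.sum_congr rfl fun b _ ↦ hT.map_smul_univ hx _ _ (fun j ↦ hc (b j) (a j))
    fun j ↦ he.smoothOn _

end IsOrthogonalFrameOn
end PseudoRiemannianMetric
end FrameChange

/-! ### Vanishing differentials imply local constancy. -/

section LocallyConstant

variable {n : ℕ} {M : Type*} [TopologicalSpace M]
  [ChartedSpace (EuclideanSpace ℝ (Fin n)) M] [IsManifold (𝓡 n) ∞ M]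

/-- In a chart this is the mean value theorem on a ball, which is convex. -/
theorem eventually_eq_of_mvfderiv_eq_zero {f : M → ℝ} {U : Set M} {x : M} (hU : IsOpen U)
    (hx : x ∈ U) (hf : SmoothFunOn (n := n) f U) (hd : ∀ y ∈ U, mvfderiv (𝓡 n) f y = 0) :
    ∀ᶠ y in 𝓝 x, f y = f x := by
  have : IsManifold (𝓡 n) 1 M := IsManifold.of_le (n := ∞) (by simp)
  set φ := extChartAt (𝓡 n) x with hφ
  have hcont : ContinuousOn φ.symm φ.target := continuousOn_extChartAt_symm x
  have hopen : IsOpen (φ.target ∩ φ.symm ⁻¹' U) :=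
    hcont.isOpen_inter_preimage (isOpen_extChartAt_target x) hU
  have hmem : φ x ∈ φ.target ∩ φ.symm ⁻¹' U :=
    ⟨mem_extChartAt_target x, by simpa [hφ] using hx⟩
  obtain ⟨r, hr, hball⟩ := Metric.isOpen_iff.mp hopen _ hmem
  have hder : ∀ z ∈ Metric.ball (φ x) r, HasFDerivAt (f ∘ φ.symm)
      (0 : EuclideanSpace ℝ (Fin n) →L[ℝ] ℝ) z := fun z hz ↦ by
    obtain ⟨hz1, hz2⟩ := hball hz
    have h1 : MDifferentiableAt 𝓘(ℝ, EuclideanSpace ℝ (Fin n)) (𝓡 n) φ.symm z :=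
      ((contMDiffOn_extChartAt_symm (n := 1) x).contMDiffAt
        ((isOpen_extChartAt_target x).mem_nhds hz1)).mdifferentiableAt one_ne_zero
    have h2 := (hf.diffFunAt hU hz2).hasMFDerivAt
    have h0 : mfderiv (𝓡 n) 𝓘(ℝ, ℝ) f (φ.symm z) = 0 := by
      ext v
      exact congrArg (fun L : TangentSpace (𝓡 n) (φ.symm z) →L[ℝ] ℝ ↦ L v) (hd _ hz2)
    have h3 := h2.comp z h1.hasMFDerivAt
    rw [h0, ContinuousLinearMap.zero_comp] at h3
    exact h3.hasFDerivAt
  have hconst : ∀ z ∈ Metric.ball (φ x) r, (f ∘ φ.symm) z = (f ∘ φ.symm) (φ x) := fun z hz ↦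
    (convex_ball (φ x) r).is_const_of_fderivWithin_eq_zero (𝕜 := ℝ)
      (fun y hy ↦ (hder y hy).differentiableAt.differentiableWithinAt)
      (fun y hy ↦ by
        rw [fderivWithin_of_isOpen Metric.isOpen_ball hy, (hder y hy).fderiv])
      hz (Metric.mem_ball_self hr)
  have hc : ContinuousAt φ x := continuousAt_extChartAt x
  filter_upwards [hc.preimage_mem_nhds (Metric.ball_mem_nhds _ hr),
    extChartAt_source_mem_nhds (I := 𝓡 n) x] with y hy hys
  have := hconst _ hy
  rwa [Function.comp_apply, Function.comp_apply, φ.left_inv hys,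
    φ.left_inv (mem_extChartAt_source x)] at this

end LocallyConstant

/-! ### The counting argument. -/

section Counting

/-- If `N` is antitone and `t ≤ d` is monotone, one of them changes strictly at each of the steps
`0, …, N 0 + d`, and `N` never decreases again after having been stationary, then `N` drops during
the first `N 0` steps and `t` starts to grow immediately afterwards. -/
theorem eq_zero_and_pos_of_steps {N t : ℕ → ℕ} {d : ℕ} (hd : 0 < d)
    (hN : ∀ q, N (q + 1) ≤ N q) (ht : ∀ q, t q ≤ t (q + 1)) (htd : ∀ q, t q ≤ d)
    (hstep : ∀ q < N 0 + d, N (q + 1) < N q ∨ t q < t (q + 1))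
    (hps : ∀ q, N q = N (q + 1) → N (q + 1) = N (q + 2)) :
    t (N 0) = 0 ∧ 0 < t (N 0 + 1) := by
  -- Each step increases `t - N` by at least 1; here counted from the start, in `hup` from the end.
  have hlow : ∀ q ≤ N 0 + d, t 0 + q + N q ≤ N 0 + t q := by
    intro q
    induction q with
    | zero => intro _; omega
    | succ q ih =>
      intro hq
      have := ih (by omega)
      have := hN q
      have := ht q
      rcases hstep q (by omega) with h | h <;> omega
  have hup : ∀ j ≤ N 0 + d, N 0 + t (N 0 + d - j) + N (N 0 + d) + j ≤
      N 0 + t (N 0 + d) + N (N 0 + d - j) := by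
    intro j
    induction j with
    | zero => intro _; simp
    | succ j ih =>
      intro hj
      have h0 := ih (by omega)
      obtain ⟨q, hq⟩ : ∃ q, q = N 0 + d - (j + 1) := ⟨_, rfl⟩
      have hq' : N 0 + d - j = q + 1 := by omega
      rw [hq'] at h0
      rw [← hq]
      have := hN q
      have := ht q
      rcases hstep q (by omega) with h | h <;> omega
  -- With `t ≤ d` this leaves no slack: `t 0 = 0`, and at the last step `t = d` and `N = 0`. The two
  -- counts then pinch to the equality `heq`.
  have hlast := hlow (N 0 + d) le_rfl
  have htd' := htd (N 0 + d)
  have heq : ∀ q ≤ N 0 + d, N 0 + t q = q + N q := by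
    intro q hq
    have h1 := hlow q hq
    have h2 := hup (N 0 + d - q) (by omega)
    have h3 : N 0 + d - (N 0 + d - q) = q := by omega
    rw [h3] at h2
    omega
  have hdrop : ∀ q < N 0, N (q + 1) < N q := by
    intro q hq
    -- A pause of `N` at `q < N 0` would be permanent, so `N q` would equal its final value 0, and
    -- `heq` would give `N 0 ≤ q`.
    by_contra hcon
    have h0 : N q = N (q + 1) := le_antisymm (not_lt.mp hcon) (hN q)
    have hst : ∀ j, N (q + j) = N (q + j + 1) := by
      intro j
      induction j with
      | zero => exact h0
      | succ j ih => exact hps _ ih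
    have hst' : ∀ j, N (q + j) = N q := by
      intro j
      induction j with
      | zero => rfl
      | succ j ih => rw [← ih]; exact (hst j).symm
    have h1 := hst' (N 0 + d - q)
    rw [show q + (N 0 + d - q) = N 0 + d by omega] at h1
    have := heq q (by omega)
    omega
  have hNq : ∀ q ≤ N 0, N q + q ≤ N 0 := by
    intro q
    induction q with
    | zero => simp
    | succ q ih =>
      intro hq
      have := ih (by omega)
      have := hdrop q (by omega)
      omega
  have h1 := hNq (N 0) le_rfl
  have h2 := heq (N 0) (by omega)
  have h3 := heq (N 0 + 1) (by omega)
  constructor <;> omega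

end Counting

/-! ### Permitted frames, the numbers t_q, and curvature homogeneity. -/

section KarlhedeAlgorithm

variable {n : ℕ} {M : Type*} [TopologicalSpace M]
  [ChartedSpace (EuclideanSpace ℝ (Fin n)) M] [IsManifold (𝓡 n) ∞ M]

theorem groupDim_mono {G H : Subgroup (GL (Fin n) ℝ)} (h : G ≤ H) : groupDim G ≤ groupDim H :=
  Submodule.finrank_mono <| Submodule.span_mono fun _ hA t ↦
    let ⟨X, hX, hX'⟩ := hA t
    ⟨X, h hX, hX'⟩

theorem groupDim_le (G : Subgroup (GL (Fin n) ℝ)) : groupDim G ≤ n * n := by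
  simpa [groupDim, Module.finrank_matrix] using Submodule.finrank_le (matrixLieAlgebra G)

omit [IsManifold (𝓡 n) ∞ M] in
theorem mvfderiv_congr {f h : M → ℝ} {x : M} (hf : f =ᶠ[𝓝 x] h) :
    mvfderiv (𝓡 n) f x = mvfderiv (𝓡 n) h x := by
  rw [mvfderiv, mvfderiv, hf.mfderiv_eq]
  rfl

namespace PseudoRiemannianMetric

variable {g : PseudoRiemannianMetric n M} {e e' : Fin n → VField n M} {x : M} {q : ℕ}

omit [IsManifold (𝓡 n) ∞ M] in
theorem finite_cotangentSpace (x : M) : Module.Finite ℝ (TangentSpace (𝓡 n) x →L[ℝ] ℝ) :=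
  inferInstanceAs (Module.Finite ℝ (EuclideanSpace ℝ (Fin n) →L[ℝ] ℝ))

omit [IsManifold (𝓡 n) ∞ M] in
theorem finrank_cotangentSpace (x : M) :
    Module.finrank ℝ (TangentSpace (𝓡 n) x →L[ℝ] ℝ) = n := by
  change Module.finrank ℝ (EuclideanSpace ℝ (Fin n) →L[ℝ] ℝ) = n
  rw [← LinearMap.toContinuousLinearMap.finrank_eq, Module.finrank_linearMap,
    Module.finrank_self, mul_one, finrank_euclideanSpace_fin]

theorem componentRank_le (e : Fin n → VField n M) (q : ℕ) (x : M) :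
    g.componentRank e q x ≤ n := by
  have := finite_cotangentSpace (n := n) x
  exact (Submodule.finrank_le _).trans (finrank_cotangentSpace x).le

theorem componentRank_mono (e : Fin n → VField n M) (x : M) :
    g.componentRank e q x ≤ g.componentRank e (q + 1) x :=
  have := finite_cotangentSpace (n := n) x
  Submodule.finrank_mono <| Submodule.span_mono fun _ ⟨i, hi, a, ha⟩ ↦ ⟨i, by omega, a, ha⟩

theorem componentRank_congr
    (h : ∀ i ≤ q, ∀ᶠ y in 𝓝 x, g.components e i y = g.components e' i y) :
    g.componentRank e q x = g.componentRank e' q x := by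
  have h' : ∀ i ≤ q, ∀ a, mvfderiv (𝓡 n) (fun y ↦ g.components e i y a) x =
      mvfderiv (𝓡 n) (fun y ↦ g.components e' i y a) x := fun i hi a ↦
    mvfderiv_congr ((h i hi).mono fun y hy ↦ congrFun hy a)
  have hset : {L : TangentSpace (𝓡 n) x →L[ℝ] ℝ | ∃ i ≤ q, ∃ a : Fin (4 + i) → Fin n,
      L = mvfderiv (𝓡 n) (fun y ↦ g.components e i y a) x} =
      {L | ∃ i ≤ q, ∃ a : Fin (4 + i) → Fin n,
      L = mvfderiv (𝓡 n) (fun y ↦ g.components e' i y a) x} := by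
    ext L
    refine exists_congr fun i ↦ and_congr_right fun hi ↦ exists_congr fun a ↦ ?_
    rw [h' i hi a]
  rw [componentRank, componentRank, hset]

theorem componentRank_eq_zero_iff : g.componentRank e q x = 0 ↔
    ∀ i ≤ q, ∀ a, mvfderiv (𝓡 n) (fun y ↦ g.components e i y a) x = 0 := by
  have := finite_cotangentSpace (n := n) x
  rw [componentRank, Submodule.finrank_eq_zero, Submodule.span_eq_bot]
  exact ⟨fun h i hi a ↦ h _ ⟨i, hi, a, rfl⟩, fun h _ ⟨i, hi, a, ha⟩ ↦ ha.trans (h i hi a)⟩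

end PseudoRiemannianMetric

namespace KarlhedeNormalization

open PseudoRiemannianMetric

variable {g : PseudoRiemannianMetric n M} {η : Matrix (Fin n) (Fin n) ℝ}
  (K : KarlhedeNormalization g η) {e e' ε : Fin n → VField n M} {U U' W : Set M} {x y : M}
  {s q : ℕ}

theorem _root_.PseudoRiemannianMetric.IsPermittedFrameOn.of_le
    {S : (i : ℕ) → Set ((Fin (4 + i) → Fin n) → ℝ)} {s s' : ℕ}
    (h : g.IsPermittedFrameOn η S s e U) (hs : s' ≤ s) : g.IsPermittedFrameOn η S s' e U :=
  ⟨h.1, fun i hi ↦ h.2 i (by omega)⟩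

theorem G_eq (he : g.IsPermittedFrameOn η K.standardForm (q + 1) e U) (hx : x ∈ U)
    (A : GL (Fin n) ℝ) : A ∈ K.G q ↔ A ∈ orthogonalGroupOf η ∧ ∀ i ≤ q,
      frameChange (A : Matrix (Fin n) (Fin n) ℝ) (g.components e i x) = g.components e i x := by
  rw [← K.automorphismGroup_eq q U e he x hx, automorphismGroup, Subgroup.mem_inf]
  simp only [Subgroup.mem_iInf, Set.mem_Iic]
  rfl

theorem mem_groupBefore (he : g.IsPermittedFrameOn η K.standardForm q e U) (hx : x ∈ U)
    {A : GL (Fin n) ℝ} (hA : A ∈ orthogonalGroupOf η) (h : ∀ i < q,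
      frameChange (A : Matrix (Fin n) (Fin n) ℝ) (g.components e i x) = g.components e i x) :
    A ∈ groupBefore η K.G q := by
  cases q with
  | zero => exact hA
  | succ q => exact (K.G_eq he hx A).mpr ⟨hA, fun i hi ↦ h i (by omega)⟩

/-- Curvature components in standard form that are related by a transformation in `O(η)`
coincide. -/
theorem components_eq_of_frameChange (he : g.IsPermittedFrameOn η K.standardForm s e U)
    (he' : g.IsPermittedFrameOn η K.standardForm s e' U') (hx : x ∈ U) (hy : y ∈ U')
    {A : GL (Fin n) ℝ} (hA : A ∈ orthogonalGroupOf η)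
    (h : ∀ i < s, g.components e' i y =
      frameChange (A : Matrix (Fin n) (Fin n) ℝ) (g.components e i x)) :
    ∀ i < s, g.components e' i y = g.components e i x := by
  intro i
  induction i using Nat.strong_induction_on with
  | _ i ih =>
    intro hi
    -- By induction the lower-order arrays at the two points agree, so `A` fixes them and lies in
    -- the group whose orbits meet `standardForm i` at most once.
    have hmem : A ∈ groupBefore η K.G i :=
      K.mem_groupBefore (he.of_le hi.le) hx hA fun j hj ↦ by
        rw [← h j (hj.trans hi), ih j hj (hj.trans hi)]
    have h1 := he'.2 i hi y hy
    rw [h i hi] at h1 ⊢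
    exact K.standardForm_unique i _ (he.2 i hi x hx) A hmem h1

theorem components_eq (hdet : IsUnit η.det)
    (he : g.IsPermittedFrameOn η K.standardForm s e U)
    (he' : g.IsPermittedFrameOn η K.standardForm s e' U') (hx : x ∈ U) (hx' : x ∈ U') :
    ∀ i < s, g.components e' i x = g.components e i x := by
  have ho := he.1.isOpen.inter he'.1.isOpen
  obtain ⟨A, hA, h⟩ := (he.1.mono ho Set.inter_subset_left).exists_components_eq_frameChange hdet
    (he'.1.mono ho Set.inter_subset_right) ⟨hx, hx'⟩
  exact K.components_eq_of_frameChange he he' hx hx' hA fun i _ ↦ h i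

/-- Where some orthogonal frame has constant curvature components, so does any permitted frame. -/
theorem components_eq_of_const (hdet : IsUnit η.det)
    (he : g.IsPermittedFrameOn η K.standardForm s e U) (hε : g.IsOrthogonalFrameOn η ε W)
    {C : (i : ℕ) → (Fin (4 + i) → Fin n) → ℝ}
    (hC : ∀ i < s, ∀ z ∈ W, g.components ε i z = C i) (hx : x ∈ U) (hxW : x ∈ W)
    (hy : y ∈ U) (hyW : y ∈ W) : ∀ i < s, g.components e i y = g.components e i x := by
  have ho := hε.isOpen.inter he.1.isOpen
  have hε' := hε.mono ho Set.inter_subset_left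
  have he' := he.1.mono ho Set.inter_subset_right
  obtain ⟨A, hA, h⟩ := hε'.exists_components_eq_frameChange hdet he' ⟨hxW, hx⟩
  obtain ⟨B, hB, h'⟩ := hε'.exists_components_eq_frameChange hdet he' ⟨hyW, hy⟩
  -- `A` and `B` carry the same constant arrays to the components at `x` and at `y`; `frameChange`
  -- is a right action, so `A⁻¹ * B` carries the former to the latter.
  refine K.components_eq_of_frameChange he he hx hy (mul_mem (inv_mem hA) hB) fun i hi ↦ ?_
  rw [h, h', hC i hi x hxW, hC i hi y hyW, ← frameChange_mul, ← Units.val_mul,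
    mul_inv_cancel_left]

theorem G_succ_le [Nonempty M] (q : ℕ) : K.G (q + 1) ≤ K.G q := by
  obtain ⟨U, e, hx, he⟩ := K.exists_permitted (q + 1) (Classical.arbitrary M)
  intro A hA
  rw [K.G_eq he hx] at hA
  rw [K.G_eq (he.of_le (by omega)) hx]
  exact ⟨hA.1, fun i hi ↦ hA.2 i (by omega)⟩

theorem t_le (q : ℕ) : K.t q ≤ n :=
  csSup_le' fun _ ⟨_, e, x, _, _, hr⟩ ↦ hr ▸ componentRank_le e q x

theorem componentRank_le_t (he : g.IsPermittedFrameOn η K.standardForm (q + 1) e U)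
    (hx : x ∈ U) : g.componentRank e q x ≤ K.t q :=
  le_csSup ⟨n, fun _ ⟨_, e, x, _, _, hr⟩ ↦ hr ▸ componentRank_le e q x⟩ ⟨U, e, x, hx, he, rfl⟩

/-- A frame competing for t_q need not normalize `R^(q+1)`. It is exchanged for one that does, whose
components up to order `q` are the same near the point. -/
theorem t_le_succ (hdet : IsUnit η.det) (q : ℕ) : K.t q ≤ K.t (q + 1) := by
  refine csSup_le' ?_
  rintro r ⟨U, e, x, hx, he, rfl⟩
  obtain ⟨U', e', hx', he'⟩ := K.exists_permitted (q + 1) x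
  refine le_trans (le_of_eq ?_) ((componentRank_mono e' x).trans (K.componentRank_le_t he' hx'))
  refine componentRank_congr fun i hi ↦ ?_
  filter_upwards [he.1.isOpen.mem_nhds hx, he'.1.isOpen.mem_nhds hx'] with y hy hy'
  exact K.components_eq hdet (he'.of_le (by omega)) he hy' hy i (by omega)

/-- Evaluating at each point an arbitrarily chosen permitted frame there gives functions on all of
`M`. They are independent of the choices, hence locally given by a single smooth frame, and rank
zero makes them locally constant. -/
theorem isCurvatureHomogeneous_of_t_eq_zero [ConnectedSpace M] (hdet : IsUnit η.det)
    (h : K.t q = 0) : g.IsCurvatureHomogeneous η q := by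
  choose U e hx he using K.exists_permitted q
  have hF (i : ℕ) (hi : i ≤ q) : IsLocallyConstant fun y ↦ g.components (e y) i y := by
    rw [IsLocallyConstant.iff_eventually_eq]
    intro x
    have hc : ∀ᶠ y in 𝓝 x, ∀ a, g.components (e x) i y a = g.components (e x) i x a := by
      rw [Filter.eventually_all]
      intro a
      refine eventually_eq_of_mvfderiv_eq_zero (he x).1.isOpen (hx x)
        ((he x).1.smoothFunOn_components hdet i a) fun y hy ↦ ?_
      have h0 := K.componentRank_le_t (he x) hy
      rw [h, Nat.le_zero, componentRank_eq_zero_iff] at h0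
      exact h0 i hi a
    filter_upwards [hc, (he x).1.isOpen.mem_nhds (hx x)] with y hy hyU
    rw [← funext hy]
    exact K.components_eq hdet (he x) (he y) hyU (hx y) i (by omega)
  refine ⟨fun i ↦ g.components (e (Classical.arbitrary M)) i (Classical.arbitrary M),
    fun x ↦ ⟨U x, e x, hx x, (he x).1, fun i hi y hy ↦ ?_⟩⟩
  exact (K.components_eq hdet (he y) (he x) (hx y) hy i (by omega)).trans
    ((hF i hi).apply_eq_of_isPreconnected isPreconnected_univ (Set.mem_univ y) (Set.mem_univ _))

/-- The frame witnessing CH_q need not be permitted, but by `components_eq_of_const` its existence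
makes the components constant near each point in every permitted frame. -/
theorem t_eq_zero_of_isCurvatureHomogeneous (hdet : IsUnit η.det)
    (h : g.IsCurvatureHomogeneous η q) : K.t q = 0 := by
  obtain ⟨C, hC⟩ := h
  refine Nat.le_zero.mp (csSup_le' ?_)
  rintro r ⟨U, e, x, hx, he, rfl⟩
  obtain ⟨W, ε, hxW, hε, hεC⟩ := hC x
  refine le_of_eq (componentRank_eq_zero_iff.mpr fun i hi a ↦ ?_)
  have hconst : (fun y ↦ g.components e i y a) =ᶠ[𝓝 x] fun _ ↦ g.components e i x a := by
    filter_upwards [he.1.isOpen.mem_nhds hx, hε.isOpen.mem_nhds hxW] with y hy hyW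
    exact congrFun (K.components_eq_of_const hdet he hε (fun i hi ↦ hεC i (by omega)) hx hxW hy
      hyW i (by omega)) a
  rw [mvfderiv_congr hconst, mvfderiv_const]

end KarlhedeNormalization

end KarlhedeAlgorithm

/-! ### The proposition. -/

theorem mainTheorem4 {n : ℕ} {M : Type*} [TopologicalSpace M]
    [ChartedSpace (EuclideanSpace ℝ (Fin n)) M] [IsManifold (𝓡 n) ∞ M] [ConnectedSpace M]
    (g : PseudoRiemannianMetric n M)
    (η : Matrix (Fin n) (Fin n) ℝ) (hη : η.IsSymm) (hdet : IsUnit η.det)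
    (K : KarlhedeNormalization g η)
    (hq : K.IsICOrder (K.N 0 + n + 1))
    (hps : ¬ K.PseudoStabilizes) :
    g.IsProperlyCurvatureHomogeneous η (K.N 0) := by
  have hstep (q : ℕ) (h : q < K.N 0 + n + 1) : K.N q < K.Nprev q ∨ K.tprev q < K.t q := by
    by_contra hcon
    exact absurd (hq.2 hcon) (by omega)
  -- In dimension zero neither alternative is possible at order 0, because all group dimensions and
  -- all t_q vanish; yet order 0 precedes q_M.
  have hn : 0 < n := by
    by_contra h0
    obtain rfl : n = 0 := by omega
    have h1 := K.t_le 0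
    have h2 := groupDim_le (groupBefore η K.G 0)
    have h3 := hstep 0 (by omega)
    simp only [KarlhedeNormalization.Nprev] at h3
    omega
  have hN (q : ℕ) : K.N (q + 1) ≤ K.N q := groupDim_mono (K.G_succ_le q)
  obtain ⟨h0, h1⟩ := eq_zero_and_pos_of_steps hn hN (K.t_le_succ hdet) K.t_le
    -- Step `q` of the count is order `q + 1` of the algorithm, since `Nprev` and `tprev` there are
    -- `N q` and `t q`; order 0, which compares with `O(η)`, is left out.
    (fun q hq ↦ hstep (q + 1) (by omega)) fun q h ↦ by
      by_contra hcon
      exact hps ⟨q, h, lt_of_le_of_ne (hN (q + 1)) (Ne.symm hcon)⟩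
  exact ⟨K.isCurvatureHomogeneous_of_t_eq_zero hdet h0,
    fun hCH ↦ h1.ne' (K.t_eq_zero_of_isCurvatureHomogeneous hdet hCH)⟩
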